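/- **Conventions.** A monoidal functor is a lax monoidal functor whose structure maps are isomorphisms. A lax comonoidal functor $(F,F^2,F^0)$ has structure maps $F^2_{x,y}\colon F(x\otimes y)\to Fx\otimes Fy$ and $F^0\colon F(1)\to 1$ with the usual coherence (oplax monoidal). A *bimonad* on a monoidal category $\mathcal M$ is a monad $\mathsf T=(T,\mu,\eta)$ on $\mathcal M$ with a lax comonoidal structure on $T$ for which $\mu$ and $\eta$ are comonoidal natural transformations. The 2-category $\mathsf{L}\text{-}\mathsf{MFunc}$ has as objects the monoidal functors $U\colon\mathcal A\to\mathcal M$ between monoidal categories whose underlying functor has a left adjoint; as 1-cells $U\to V$ (with $V\colon\mathcal B\to\mathcal N$) the triples $\langle F,\kappa,G\rangle$ of lax monoidal functors $F\colon\mathcal A\to\mathcal B$, $G\colon\mathcal M\to\mathcal N$ and a monoidal natural isomorphism $\kappa\colon GU\to VF$; as 2-cells $\langle F,\kappa,G\rangle\to\langle F',\kappa',G'\rangle$ the pairs $[\vartheta,\nu]$ of monoidal natural transformations $\vartheta\colon F\to F'$, $\nu\colon G\to G'$ with $V\vartheta\circ\kappa=\kappa'\circ\nu U$. The 2-category $\mathsf{Bmd}$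 has as objects the pairs $(\mathcal M,\mathsf T)$ with $\mathsf T$ a bimonad on $\mathcal M$; as 1-cells $(\mathcal M,\mathsf R)\to(\mathcal N,\mathsf S)$ the pairs $\langle G,\varphi\rangle$ of a lax monoidal functor $G\colon\mathcal M\to\mathcal N$ and a natural transformation $\varphi\colon SG\to GR$ satisfying $\varphi\circ\mu^{\mathsf S}G=G\mu^{\mathsf R}\circ\varphi R\circ S\varphi$, $\varphi\circ\eta^{\mathsf S}G=G\eta^{\mathsf R}$ and the ambimonoidality conditions $$G(R^2_{x,y})\circ\varphi_{x\otimes y}\circ S(G_{2;x,y})=G_{2;Rx,Ry}\circ(\varphi_x\otimes\varphi_y)\circ S^2_{Gx,Gy},\qquad G(R^0)\circ\varphi_1\circ S(G_0)=G_0\circ S^0;$$ as 2-cells $\langle G,\varphi\rangle\to\langle G',\varphi'\rangle$ the monoidal natural transformations $\nu\colon G\to G'$ with $\nu R\circ\varphi=\varphi'\circ S\nu$. In both 2-categories composition is the evident pasting. Choose for every object $U\colon\mathcal A\to\mathcal M$ of $\mathsf{L}\text{-}\mathsf{MFunc}$ a left adjoint $\bar U$ with unit and counit $\varepsilon_U$.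 The 2-functor $\mathbb Q\colon\mathsf{L}\text{-}\mathsf{MFunc}\to\mathsf{Bmd}$ sends $U$ to the bimonad on $\mathcal M$ whose monad is the one induced by the adjunction on $U\bar U$ and whose comonoidal structure is the composite of that of $\bar U$ (the mate of the monoidal structure of $U$) with the inverse of that of $U$; it sends $\langle F,\kappa,G\rangle\colon U\to V$ to $\langle G,\varphi\rangle$, where $\varphi\colon V\bar VG\to GU\bar U$ is the unique natural transformation with $V\varepsilon_VF\circ V\bar V\kappa=\kappa\circ GU\varepsilon_U\circ\varphi U$; and it sends $[\vartheta,\nu]$ to $\nu$. The 2-functor $\mathbb{EM}\colon\mathsf{Bmd}\to\mathsf{L}\text{-}\mathsf{MFunc}$ sends $(\mathcal M,\mathsf T)$ to the forgetful functor $U^{\mathsf T}\colon\mathcal M^{\mathsf T}\to\mathcal M$ of the Eilenberg–Moore category, with the monoidal structure on $\mathcal M^{\mathsf T}$ that makes $U^{\mathsf T}$ strict monoidal; it sends $\langle G,\varphi\rangle$ to $\langle G^\varphi,=,G\rangle$ with $G^\varphi\langle x,\alpha\rangle=\langle Gx,G\alpha\circ\varphi_x\rangle$ and the lax monoidal structure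 lifted from $G$, and $\nu$ to $[\hat\nu,\nu]$ with $\hat\nu$ the lift of $\nu$. **Theorem.** For every choice of the adjunctions, $\mathbb Q$ is a pseudo left adjoint of $\mathbb{EM}$ in the following sense: there exist pseudo natural transformations $$\zeta\colon\mathbb Q\ast\mathbb{EM}\to\mathsf{Bmd},\qquad \xi\colon\mathsf{L}\text{-}\mathsf{MFunc}\to\mathbb{EM}\ast\mathbb Q$$ (where a 2-category denotes its identity 2-functor, and the naturality 2-cells of a pseudo natural transformation are invertible and coherent), such that $\zeta$ is 2-natural, i.e. its naturality 2-cells are identities, and the triangle identities $$(\zeta\ast\mathbb Q)\odot(\mathbb Q\ast\xi)=\mathbb Q,\qquad(\mathbb{EM}\ast\zeta)\odot(\xi\ast\mathbb{EM})=\mathbb{EM}$$ hold as equalities of pseudo natural transformations (equality of the component 1-cells and of the naturality 2-cells with those of the identity transformations of $\mathbb Q$ and $\mathbb{EM}$; $\odot$ is componentwise composition). -/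

import Mathlib

open CategoryTheory

universe v u

namespace BimonadEM

section Whiskering

open Bicategory

universe w₁ w₂ w₃ v₁ v₂ v₃ u₁ u₂ u₃

variable {A : Type u₁} [Bicategory.{w₁, v₁} A] {B : Type u₂} [Bicategory.{w₂, v₂} B]
  {C : Type u₃} [Bicategory.{w₃, v₃} C]

/-- Precomposition of a pseudo natural transformation with a pseudofunctor. -/
def preWhisker (H : Pseudofunctor A B) {F G : Pseudofunctor B C} (η : Pseudofunctor.StrongTrans F G) :
    Pseudofunctor.StrongTrans (H.comp F) (H.comp G) where
  app a := η.app (H.obj a)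
  naturality f := η.naturality (H.map f)
  naturality_naturality t := η.naturality_naturality (H.map₂ t)
  naturality_id a := by
    have h := η.naturality_id (H.obj a)
    have h' := η.naturality_naturality (H.mapId a).hom
    change (η.naturality (H.map (𝟙 a))).hom ≫
        η.app (H.obj a) ◁ (G.map₂ (H.mapId a).hom ≫ (G.mapId (H.obj a)).hom) =
      (F.map₂ (H.mapId a).hom ≫ (F.mapId (H.obj a)).hom) ▷ η.app (H.obj a) ≫
        (λ_ (η.app (H.obj a))).hom ≫ (ρ_ (η.app (H.obj a))).inv
    rw [Bicategory.whiskerLeft_comp, comp_whiskerRight, ← reassoc_of% h', h, Category.assoc]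
  naturality_comp f g := by
    have h := η.naturality_comp (H.map f) (H.map g)
    have h' := η.naturality_naturality (H.mapComp f g).hom
    change (η.naturality (H.map (f ≫ g))).hom ≫
        η.app _ ◁ (G.map₂ (H.mapComp f g).hom ≫ (G.mapComp (H.map f) (H.map g)).hom) =
      (F.map₂ (H.mapComp f g).hom ≫ (F.mapComp (H.map f) (H.map g)).hom) ▷ η.app _ ≫ _
    rw [Bicategory.whiskerLeft_comp, comp_whiskerRight, ← reassoc_of% h', h]
    exact (Category.assoc _ _ _).symm

theorem map₂_wR (K : Pseudofunctor B C) {a b c : B} {f g : a ⟶ b} (t : f ⟶ g) (h : b ⟶ c) :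
    K.map₂ t ▷ K.map h = (K.mapComp f h).inv ≫ K.map₂ (t ▷ h) ≫ (K.mapComp g h).hom := by
  simp

theorem map₂_wL (K : Pseudofunctor B C) {a b c : B} (h : a ⟶ b) {f g : b ⟶ c} (t : f ⟶ g) :
    K.map h ◁ K.map₂ t = (K.mapComp h f).inv ≫ K.map₂ (h ◁ t) ≫ (K.mapComp h g).hom := by
  simp

/-- Postcomposition of a pseudo natural transformation with a pseudofunctor: the 2-cell at `f` is
the image under `K` of the 2-cell at `f`, up to the constraints of `K`. -/
def postWhisker {F G : Pseudofunctor A B} (η : Pseudofunctor.StrongTrans F G) (K : Pseudofunctor B C) :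
    Pseudofunctor.StrongTrans (F.comp K) (G.comp K) where
  app a := K.map (η.app a)
  naturality {a b} f := (K.mapComp (F.map f) (η.app b)).symm ≪≫ K.map₂Iso (η.naturality f) ≪≫
    K.mapComp (η.app a) (G.map f)
  naturality_naturality {a b f g} t := by
    change K.map₂ (F.map₂ t) ▷ K.map (η.app b) ≫ (K.mapComp _ _).inv ≫
      K.map₂ (η.naturality g).hom ≫ (K.mapComp _ _).hom = ((K.mapComp _ _).inv ≫
      K.map₂ (η.naturality f).hom ≫ (K.mapComp _ _).hom) ≫ K.map (η.app a) ◁ K.map₂ (G.map₂ t)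
    rw [map₂_wR, map₂_wL]
    simp only [Category.assoc, Iso.hom_inv_id_assoc]
    rw [← K.map₂_comp_assoc, η.naturality_naturality, K.map₂_comp_assoc]
  naturality_id a := by
    change ((K.mapComp _ _).inv ≫ K.map₂ (η.naturality (𝟙 a)).hom ≫ (K.mapComp _ _).hom) ≫
        K.map (η.app a) ◁ (K.map₂ (G.mapId a).hom ≫ (K.mapId _).hom) =
      (K.map₂ (F.mapId a).hom ≫ (K.mapId _).hom) ▷ K.map (η.app a) ≫ (λ_ _).hom ≫ (ρ_ _).inv
    rw [Bicategory.whiskerLeft_comp, comp_whiskerRight, map₂_wL, map₂_wR]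
    have h := congrArg K.map₂ (η.naturality_id a)
    simp only [K.map₂_comp] at h
    simp only [Category.assoc, Iso.hom_inv_id_assoc]
    have h1 : K.map₂ (ρ_ (η.app a)).inv ≫ (K.mapComp (η.app a) (𝟙 _)).hom ≫
        K.map (η.app a) ◁ (K.mapId _).hom = (ρ_ _).inv := by
      rw [← cancel_mono (ρ_ _).hom, Category.assoc, Category.assoc, ← K.map₂_right_unitor,
        ← K.map₂_comp]
      simp
    rw [reassoc_of% h]
    simp [h1]
  naturality_comp {a b c} f g := by
    change ((K.mapComp _ _).inv ≫ K.map₂ (η.naturality (f ≫ g)).hom ≫ (K.mapComp _ _).hom) ≫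
        K.map (η.app a) ◁ (K.map₂ (G.mapComp f g).hom ≫ (K.mapComp _ _).hom) =
      (K.map₂ (F.mapComp f g).hom ≫ (K.mapComp _ _).hom) ▷ K.map (η.app c) ≫ (α_ _ _ _).hom ≫
        K.map (F.map f) ◁ ((K.mapComp _ _).inv ≫ K.map₂ (η.naturality g).hom ≫
          (K.mapComp _ _).hom) ≫ (α_ _ _ _).inv ≫ ((K.mapComp _ _).inv ≫
          K.map₂ (η.naturality f).hom ≫ (K.mapComp _ _).hom) ▷ K.map (G.map g) ≫ (α_ _ _ _).hom
    have h := congrArg K.map₂ (η.naturality_comp f g)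
    simp only [K.map₂_comp] at h
    simp only [Bicategory.whiskerLeft_comp, comp_whiskerRight, map₂_wL, map₂_wR]
    simp only [Category.assoc, Iso.hom_inv_id_assoc]
    have h1 := K.mapComp_assoc_right_hom (F.map f) (η.app b) (G.map g)
    have h2 : (K.mapComp (F.map f) (η.app b ≫ G.map g)).inv ≫
        K.map₂ (α_ (F.map f) (η.app b) (G.map g)).inv ≫
          (K.mapComp (F.map f ≫ η.app b) (G.map g)).hom =
        K.map (F.map f) ◁ (K.mapComp (η.app b) (G.map g)).hom ≫ (α_ _ _ _).inv ≫
          (K.mapComp (F.map f) (η.app b)).inv ▷ K.map (G.map g) := by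
      rw [Iso.inv_comp_eq, reassoc_of% h1]
      simp
    rw [reassoc_of% h]
    simp [reassoc_of% h2]

/-- A pseudo natural transformation is 2-natural if its naturality squares commute strictly and its
naturality 2-cells are identities. -/
def Is2Natural {F G : Pseudofunctor A B} (η : Pseudofunctor.StrongTrans F G) : Prop :=
  ∀ ⦃a b : A⦄ (f : a ⟶ b), ∃ h : F.map f ≫ η.app b = η.app a ≫ G.map f,
    η.naturality f = eqToIso h

section Constraints

variable {D : Type*} [Bicategory D]

theorem id_comp_mapId (F : Pseudofunctor A B) (a : A) :
    (((Pseudofunctor.id A).comp F).mapId a).hom = (F.mapId a).hom := by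
  change F.map₂ (𝟙 _) ≫ (F.mapId a).hom = _
  rw [F.map₂_id]
  exact Category.id_comp _

theorem id_comp_mapComp (F : Pseudofunctor A B) {a b c : A} (f : a ⟶ b) (g : b ⟶ c) :
    (((Pseudofunctor.id A).comp F).mapComp f g).hom = (F.mapComp f g).hom := by
  change F.map₂ (𝟙 _) ≫ (F.mapComp f g).hom = _
  rw [F.map₂_id]
  exact Category.id_comp _

theorem comp_id_mapId (F : Pseudofunctor A B) (a : A) :
    ((F.comp (Pseudofunctor.id B)).mapId a).hom = (F.mapId a).hom :=
  Category.comp_id _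

theorem comp_id_mapComp (F : Pseudofunctor A B) {a b c : A} (f : a ⟶ b) (g : b ⟶ c) :
    ((F.comp (Pseudofunctor.id B)).mapComp f g).hom = (F.mapComp f g).hom :=
  Category.comp_id _

theorem assoc_mapId (F : Pseudofunctor A B) (G : Pseudofunctor B C) (H : Pseudofunctor C D)
    (a : A) : (((F.comp G).comp H).mapId a).hom = ((F.comp (G.comp H)).mapId a).hom := by
  change H.map₂ (G.map₂ (F.mapId a).hom ≫ (G.mapId _).hom) ≫ (H.mapId _).hom =
    H.map₂ (G.map₂ (F.mapId a).hom) ≫ H.map₂ (G.mapId _).hom ≫ (H.mapId _).hom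
  rw [H.map₂_comp]
  exact Category.assoc _ _ _

theorem assoc_mapComp (F : Pseudofunctor A B) (G : Pseudofunctor B C) (H : Pseudofunctor C D)
    {a b c : A} (f : a ⟶ b) (g : b ⟶ c) :
    (((F.comp G).comp H).mapComp f g).hom = ((F.comp (G.comp H)).mapComp f g).hom := by
  change H.map₂ (G.map₂ (F.mapComp f g).hom ≫ (G.mapComp _ _).hom) ≫ (H.mapComp _ _).hom =
    H.map₂ (G.map₂ (F.mapComp f g).hom) ≫ H.map₂ (G.mapComp _ _).hom ≫ (H.mapComp _ _).hom
  rw [H.map₂_comp]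
  exact Category.assoc _ _ _

end Constraints

section Triangles

variable {F : Pseudofunctor B C} {G : Pseudofunctor C B}

/-- `F ∗ ξ : F ⟶ FGF` for `ξ : 1 ⟶ GF`. -/
def unitPost (ξ : Pseudofunctor.StrongTrans (Pseudofunctor.id B) (F.comp G)) :
    Pseudofunctor.StrongTrans F ((F.comp G).comp F) where
  app := (postWhisker ξ F).app
  naturality := (postWhisker ξ F).naturality
  naturality_naturality := (postWhisker ξ F).naturality_naturality
  naturality_id a := by
    have h := (postWhisker ξ F).naturality_id a
    exact (congrArg (fun t => _ ≫ (_ ◁ t)) rfl).trans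
      (h.trans (congrArg (fun t => t ▷ _ ≫ _) (id_comp_mapId F a)))
  naturality_comp f g := by
    have h := (postWhisker ξ F).naturality_comp f g
    exact (congrArg (fun t => _ ≫ (_ ◁ t)) rfl).trans
      (h.trans (congrArg (fun t => t ▷ _ ≫ _) (id_comp_mapComp F f g)))

/-- `ζ ∗ F : FGF ⟶ F` for `ζ : FG ⟶ 1`. -/
def counitPre (ζ : Pseudofunctor.StrongTrans (G.comp F) (Pseudofunctor.id C)) :
    Pseudofunctor.StrongTrans ((F.comp G).comp F) F where
  app := (preWhisker F ζ).app
  naturality := (preWhisker F ζ).naturality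
  naturality_naturality := (preWhisker F ζ).naturality_naturality
  naturality_id a := by
    have h := (preWhisker F ζ).naturality_id a
    exact (congrArg (fun t => _ ≫ (_ ◁ t)) ((comp_id_mapId F a).symm)).trans
      (h.trans (congrArg (fun t => t ▷ _ ≫ _) ((assoc_mapId F G F a).symm)))
  naturality_comp f g := by
    have h := (preWhisker F ζ).naturality_comp f g
    exact (congrArg (fun t => _ ≫ (_ ◁ t)) ((comp_id_mapComp F f g).symm)).trans
      (h.trans (congrArg (fun t => t ▷ _ ≫ _) ((assoc_mapComp F G F f g).symm)))

/-- `ξ ∗ G : G ⟶ GFG` for `ξ : 1 ⟶ GF`. -/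
def unitPre (ξ : Pseudofunctor.StrongTrans (Pseudofunctor.id B) (F.comp G)) :
    Pseudofunctor.StrongTrans G ((G.comp F).comp G) where
  app := (preWhisker G ξ).app
  naturality := (preWhisker G ξ).naturality
  naturality_naturality := (preWhisker G ξ).naturality_naturality
  naturality_id a := by
    have h := (preWhisker G ξ).naturality_id a
    exact (congrArg (fun t => _ ≫ (_ ◁ t)) (assoc_mapId G F G a)).trans
      (h.trans (congrArg (fun t => t ▷ _ ≫ _) (comp_id_mapId G a)))
  naturality_comp f g := by
    have h := (preWhisker G ξ).naturality_comp f g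
    exact (congrArg (fun t => _ ≫ (_ ◁ t)) (assoc_mapComp G F G f g)).trans
      (h.trans (congrArg (fun t => t ▷ _ ≫ _) (comp_id_mapComp G f g)))

/-- `G ∗ ζ : GFG ⟶ G` for `ζ : FG ⟶ 1`. -/
def counitPost (ζ : Pseudofunctor.StrongTrans (G.comp F) (Pseudofunctor.id C)) :
    Pseudofunctor.StrongTrans ((G.comp F).comp G) G where
  app := (postWhisker ζ G).app
  naturality := (postWhisker ζ G).naturality
  naturality_naturality := (postWhisker ζ G).naturality_naturality
  naturality_id a := by
    have h := (postWhisker ζ G).naturality_id a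
    exact (congrArg (fun t => _ ≫ (_ ◁ t)) ((id_comp_mapId G a).symm)).trans
      (h.trans (congrArg (fun t => t ▷ _ ≫ _) rfl))
  naturality_comp f g := by
    have h := (postWhisker ζ G).naturality_comp f g
    exact (congrArg (fun t => _ ≫ (_ ◁ t)) ((id_comp_mapComp G f g).symm)).trans
      (h.trans (congrArg (fun t => t ▷ _ ≫ _) rfl))

end Triangles

end Whiskering

open MonoidalCategory Functor.LaxMonoidal Functor.OplaxMonoidal

/-- A bimonad on a monoidal category: a monad whose underlying functor is lax comonoidal
(`OplaxMonoidal` in Mathlib's terminology) and whose multiplication and unit are comonoidal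
natural transformations. -/
class Bimonad {M : Type u} [Category.{v} M] [MonoidalCategory M] (T : Monad M)
    extends T.toFunctor.OplaxMonoidal where
  mul_tensor (X Y : M) :
    T.μ.app (X ⊗ Y) ≫ δ X Y =
      T.map (δ X Y) ≫ δ (T.obj X) (T.obj Y) ≫ (T.μ.app X ⊗ₘ T.μ.app Y)
  mul_unit : T.μ.app (𝟙_ M) ≫ η = T.map η ≫ η
  unit_tensor (X Y : M) : T.η.app (X ⊗ Y) ≫ δ X Y = (T.η.app X ⊗ₘ T.η.app Y)
  unit_unit : T.η.app (𝟙_ M) ≫ η = 𝟙 (𝟙_ M)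

section EilenbergMoore

variable {M : Type u} [Category.{v} M] [MonoidalCategory M] (T : Monad M) [Bimonad T]

/-- The tensor product of algebras over a bimonad. -/
def algTensor (A B : T.Algebra) : T.Algebra where
  A := A.A ⊗ B.A
  a := δ T.toFunctor A.A B.A ≫ (A.a ⊗ₘ B.a)
  unit := by
    have h : T.η.app (A.A ⊗ B.A) ≫ δ T.toFunctor A.A B.A = _ := Bimonad.unit_tensor A.A B.A
    rw [reassoc_of% h, tensorHom_comp_tensorHom, A.unit, B.unit, id_tensorHom_id]
  assoc := by
    have h : T.μ.app (A.A ⊗ B.A) ≫ δ T.toFunctor A.A B.A =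
      T.map (δ T.toFunctor A.A B.A) ≫ δ T.toFunctor (T.obj A.A) (T.obj B.A) ≫ _ :=
        Bimonad.mul_tensor A.A B.A
    rw [reassoc_of% h, tensorHom_comp_tensorHom, A.assoc, B.assoc, Functor.map_comp,
      Category.assoc, ← tensorHom_comp_tensorHom, δ_natural_assoc]

/-- The unit object of the category of algebras over a bimonad. -/
def algUnit : T.Algebra where
  A := 𝟙_ M
  a := η T.toFunctor
  unit := Bimonad.unit_unit
  assoc := Bimonad.mul_unit

/-- The Eilenberg–Moore category of a bimonad is monoidal: the tensor product of morphisms and the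
coherence isomorphisms are those of the base category. -/
instance algMonoidal : MonoidalCategory T.Algebra where
  tensorObj := algTensor T
  tensorUnit := algUnit T
  tensorHom f g := ⟨f.f ⊗ₘ g.f, by
    simp [algTensor, ← δ_natural_assoc, tensorHom_comp_tensorHom]⟩
  whiskerLeft X _ _ g := ⟨X.A ◁ g.f, by
    have e : T.map (X.A ◁ g.f) ≫ δ T.toFunctor _ _ = δ T.toFunctor _ _ ≫ T.obj X.A ◁ T.map g.f :=
      (δ_natural_right T.toFunctor X.A g.f).symm
    dsimp only [algTensor]
    rw [reassoc_of% e, Category.assoc, ← id_tensorHom, ← id_tensorHom, tensorHom_comp_tensorHom,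
      tensorHom_comp_tensorHom, g.h, Category.comp_id, Category.id_comp]⟩
  whiskerRight f Y := ⟨f.f ▷ Y.A, by
    have e : T.map (f.f ▷ Y.A) ≫ δ T.toFunctor _ _ = δ T.toFunctor _ _ ≫ T.map f.f ▷ T.obj Y.A :=
      (δ_natural_left T.toFunctor f.f Y.A).symm
    dsimp only [algTensor]
    rw [reassoc_of% e, Category.assoc, ← tensorHom_id, ← tensorHom_id, tensorHom_comp_tensorHom,
      tensorHom_comp_tensorHom, f.h, Category.comp_id, Category.id_comp]⟩
  associator X Y Z := Monad.Algebra.isoMk (α_ X.A Y.A Z.A) (by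
    have h : δ T.toFunctor (X.A ⊗ Y.A) Z.A ≫ δ T.toFunctor X.A Y.A ▷ T.obj Z.A ≫
        (α_ (T.obj X.A) (T.obj Y.A) (T.obj Z.A)).hom =
      T.map (α_ X.A Y.A Z.A).hom ≫ δ T.toFunctor X.A (Y.A ⊗ Z.A) ≫
        T.obj X.A ◁ δ T.toFunctor Y.A Z.A := oplax_associativity T.toFunctor X.A Y.A Z.A
    have e1 : X.a ⊗ₘ (δ T.toFunctor Y.A Z.A ≫ (Y.a ⊗ₘ Z.a)) =
      T.obj X.A ◁ δ T.toFunctor Y.A Z.A ≫ (X.a ⊗ₘ (Y.a ⊗ₘ Z.a)) := by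
        rw [← id_tensorHom, tensorHom_comp_tensorHom, Category.id_comp]
    have e2 : (δ T.toFunctor X.A Y.A ≫ (X.a ⊗ₘ Y.a)) ⊗ₘ Z.a =
      δ T.toFunctor X.A Y.A ▷ T.obj Z.A ≫ ((X.a ⊗ₘ Y.a) ⊗ₘ Z.a) := by
        rw [← tensorHom_id, tensorHom_comp_tensorHom, Category.id_comp]
    dsimp only [algTensor]
    rw [e1, e2, Category.assoc, Category.assoc, associator_naturality, ← reassoc_of% h])
  leftUnitor X := Monad.Algebra.isoMk (λ_ X.A) (by
    have h : δ T.toFunctor (𝟙_ M) X.A ≫ η T.toFunctor ▷ T.obj X.A ≫ (λ_ (T.obj X.A)).hom =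
      T.map (λ_ X.A).hom := left_unitality_hom T.toFunctor X.A
    dsimp only [algTensor, algUnit]
    rw [MonoidalCategory.tensorHom_def, Category.assoc, Category.assoc, leftUnitor_naturality, ← h]
    simp only [Category.assoc])
  rightUnitor X := Monad.Algebra.isoMk (ρ_ X.A) (by
    have h : δ T.toFunctor X.A (𝟙_ M) ≫ T.obj X.A ◁ η T.toFunctor ≫ (ρ_ (T.obj X.A)).hom =
      T.map (ρ_ X.A).hom := right_unitality_hom T.toFunctor X.A
    dsimp only [algTensor, algUnit]
    rw [tensorHom_def', Category.assoc, Category.assoc, rightUnitor_naturality, ← h]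
    simp only [Category.assoc])
  tensorHom_def _ _ := by ext; exact MonoidalCategory.tensorHom_def _ _
  id_tensorHom_id _ _ := by ext; exact id_tensorHom_id _ _
  tensorHom_comp_tensorHom _ _ _ _ := by ext; exact tensorHom_comp_tensorHom _ _ _ _
  whiskerLeft_id _ _ := by ext; exact MonoidalCategory.whiskerLeft_id _ _
  id_whiskerRight _ _ := by ext; exact MonoidalCategory.id_whiskerRight _ _
  associator_naturality _ _ _ := by ext; exact associator_naturality _ _ _
  leftUnitor_naturality _ := by ext; exact leftUnitor_naturality _
  rightUnitor_naturality _ := by ext; exact rightUnitor_naturality _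
  pentagon _ _ _ _ := by ext; exact pentagon _ _ _ _
  triangle _ _ := by ext; exact triangle _ _

/-- The forgetful functor of the Eilenberg–Moore category is strict monoidal. -/
instance forgetMonoidal : T.forget.Monoidal where
  ε := 𝟙 (𝟙_ M)
  η := 𝟙 (𝟙_ M)
  μ X Y := 𝟙 (X.A ⊗ Y.A)
  δ X Y := 𝟙 (X.A ⊗ Y.A)
  μ_natural_left _ _ := (Category.comp_id _).trans (Category.id_comp _).symm
  μ_natural_right _ _ := (Category.comp_id _).trans (Category.id_comp _).symm
  δ_natural_left _ _ := (Category.id_comp _).trans (Category.comp_id _).symm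
  δ_natural_right _ _ := (Category.id_comp _).trans (Category.comp_id _).symm
  associativity X Y Z := by
    change 𝟙 (X.A ⊗ Y.A) ▷ Z.A ≫ 𝟙 _ ≫ (α_ X.A Y.A Z.A).hom =
      (α_ X.A Y.A Z.A).hom ≫ X.A ◁ 𝟙 (Y.A ⊗ Z.A) ≫ 𝟙 _
    simp
  left_unitality X := by
    change (λ_ X.A).hom = 𝟙 (𝟙_ M) ▷ X.A ≫ 𝟙 _ ≫ (λ_ X.A).hom
    simp
  right_unitality X := by
    change (ρ_ X.A).hom = X.A ◁ 𝟙 (𝟙_ M) ≫ 𝟙 _ ≫ (ρ_ X.A).hom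
    simp
  oplax_associativity X Y Z := by
    change 𝟙 _ ≫ 𝟙 (X.A ⊗ Y.A) ▷ Z.A ≫ (α_ X.A Y.A Z.A).hom =
      (α_ X.A Y.A Z.A).hom ≫ 𝟙 _ ≫ X.A ◁ 𝟙 (Y.A ⊗ Z.A)
    simp
  oplax_left_unitality X := by
    change (λ_ X.A).inv = (λ_ X.A).inv ≫ 𝟙 _ ≫ 𝟙 (𝟙_ M) ▷ X.A
    simp
  oplax_right_unitality X := by
    change (ρ_ X.A).inv = (ρ_ X.A).inv ≫ 𝟙 _ ≫ X.A ◁ 𝟙 (𝟙_ M)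
    simp
  ε_η := Category.comp_id _
  η_ε := Category.comp_id _
  μ_δ _ _ := Category.comp_id _
  δ_μ _ _ := Category.comp_id _

end EilenbergMoore

/-- An object of the 2-category `L-MFunc`: a monoidal functor `U : A ⥤ M` between monoidal
categories whose underlying functor has a left adjoint. The universe levels are such that the
Eilenberg–Moore category of a monad on `M` is again an allowed domain. -/
structure LMFunc where
  dom : Type (max u v)
  cod : Type u
  [domCat : Category.{v} dom]
  [domMon : MonoidalCategory dom]
  [codCat : Category.{v} cod]
  [codMon : MonoidalCategory cod]
  U : dom ⥤ cod
  [monoidal : U.Monoidal]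
  [hasLeftAdjoint : U.IsRightAdjoint]

namespace LMFunc

attribute [instance] domCat domMon codCat codMon monoidal hasLeftAdjoint

/-- A 1-cell of `L-MFunc`: lax monoidal functors `F`, `G` and a monoidal natural isomorphism
`κ : GU ≅ VF`. -/
structure Hom₁ (U V : LMFunc.{v, u}) where
  F : U.dom ⥤ V.dom
  G : U.cod ⥤ V.cod
  [laxF : F.LaxMonoidal]
  [laxG : G.LaxMonoidal]
  κ : U.U ⋙ G ≅ F ⋙ V.U
  [monκ : NatTrans.IsMonoidal κ.hom]

attribute [instance] Hom₁.laxF Hom₁.laxG Hom₁.monκ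

theorem Hom₁.mk_congr {U V : LMFunc.{v, u}} {F : U.dom ⥤ V.dom} {G : U.cod ⥤ V.cod}
    {l l' : F.LaxMonoidal} {m m' : G.LaxMonoidal} {κ κ' : U.U ⋙ G ≅ F ⋙ V.U}
    {p : @NatTrans.IsMonoidal _ _ _ _ _ _ _ _ κ.hom
      (@Functor.LaxMonoidal.comp _ _ _ _ _ _ _ _ _ U.U G _ m)
      (@Functor.LaxMonoidal.comp _ _ _ _ _ _ _ _ _ F V.U l _)}
    {p' : @NatTrans.IsMonoidal _ _ _ _ _ _ _ _ κ'.hom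
      (@Functor.LaxMonoidal.comp _ _ _ _ _ _ _ _ _ U.U G _ m')
      (@Functor.LaxMonoidal.comp _ _ _ _ _ _ _ _ _ F V.U l' _)}
    (hl : l = l') (hm : m = m') (hκ : κ = κ') :
    @Hom₁.mk U V F G l m κ p = @Hom₁.mk U V F G l' m' κ' p' := by
  subst hl hm hκ
  rfl

/-- A 2-cell of `L-MFunc`: monoidal natural transformations `θ : F ⟶ F'`, `ν : G ⟶ G'` with
`Vθ ∘ κ = κ' ∘ νU`. -/
@[ext]
structure Hom₂ {U V : LMFunc.{v, u}} (f g : Hom₁ U V) where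
  θ : f.F ⟶ g.F
  ν : f.G ⟶ g.G
  [monθ : NatTrans.IsMonoidal θ]
  [monν : NatTrans.IsMonoidal ν]
  comm : ∀ a : U.dom,
    f.κ.hom.app a ≫ V.U.map (θ.app a) = ν.app (U.U.obj a) ≫ g.κ.hom.app a

attribute [instance] Hom₂.monθ Hom₂.monν

/-- The identity 1-cell. -/
def id₁ (U : LMFunc.{v, u}) : Hom₁ U U where
  F := 𝟭 _
  G := 𝟭 _
  κ := NatIso.ofComponents (fun a => Iso.refl (U.U.obj a))
  monκ := ⟨by simp, by simp⟩

/-- The composite of 1-cells: `⟨H, ℓ, I⟩ □ ⟨F, κ, G⟩ = ⟨HF, ℓF ∘ Iκ, IG⟩`. -/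
def comp₁ {U V W : LMFunc.{v, u}} (f : Hom₁ U V) (g : Hom₁ V W) : Hom₁ U W where
  F := f.F ⋙ g.F
  G := f.G ⋙ g.G
  κ := NatIso.ofComponents (fun a => g.G.mapIso (f.κ.app a) ≪≫ g.κ.app (f.F.obj a)) (by
    intro a b h
    have h1 : f.G.map (U.U.map h) ≫ f.κ.hom.app b = f.κ.hom.app a ≫ V.U.map (f.F.map h) :=
      f.κ.hom.naturality h
    have h2 : g.G.map (V.U.map (f.F.map h)) ≫ g.κ.hom.app (f.F.obj b) =
      g.κ.hom.app (f.F.obj a) ≫ W.U.map (g.F.map (f.F.map h)) := g.κ.hom.naturality (f.F.map h)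
    change g.G.map (f.G.map (U.U.map h)) ≫ g.G.map (f.κ.hom.app b) ≫ g.κ.hom.app (f.F.obj b) =
      (g.G.map (f.κ.hom.app a) ≫ g.κ.hom.app (f.F.obj a)) ≫ W.U.map (g.F.map (f.F.map h))
    rw [← Functor.map_comp_assoc, h1, Functor.map_comp_assoc, h2, Category.assoc])
  monκ := by
    constructor
    · have h1 : (ε f.G ≫ f.G.map (ε U.U)) ≫ f.κ.hom.app (𝟙_ _) = ε V.U ≫ V.U.map (ε f.F) :=
        NatTrans.IsMonoidal.unit (τ := f.κ.hom)
      have h2 : (ε g.G ≫ g.G.map (ε V.U)) ≫ g.κ.hom.app (𝟙_ _) = ε W.U ≫ W.U.map (ε g.F) :=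
        NatTrans.IsMonoidal.unit (τ := g.κ.hom)
      have h3 : g.G.map (V.U.map (ε f.F)) ≫ g.κ.hom.app (f.F.obj (𝟙_ _)) =
        g.κ.hom.app (𝟙_ _) ≫ W.U.map (g.F.map (ε f.F)) := g.κ.hom.naturality (ε f.F)
      change ((ε g.G ≫ g.G.map (ε f.G)) ≫ g.G.map (f.G.map (ε U.U))) ≫
          g.G.map (f.κ.hom.app (𝟙_ _)) ≫ g.κ.hom.app (f.F.obj (𝟙_ _)) =
        ε W.U ≫ W.U.map (ε g.F ≫ g.F.map (ε f.F))
      have h1' := congrArg g.G.map h1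
      simp only [Functor.map_comp, Category.assoc] at h1' h2 ⊢
      rw [reassoc_of% h1', h3, reassoc_of% h2]
    · intro X Y
      have h1 : (μ f.G _ _ ≫ f.G.map (μ U.U X Y)) ≫ f.κ.hom.app (X ⊗ Y) =
          (f.κ.hom.app X ⊗ₘ f.κ.hom.app Y) ≫ μ V.U _ _ ≫ V.U.map (μ f.F X Y) :=
        NatTrans.IsMonoidal.tensor (τ := f.κ.hom) X Y
      have h2 : (μ g.G _ _ ≫ g.G.map (μ V.U _ _)) ≫ g.κ.hom.app (f.F.obj X ⊗ f.F.obj Y) =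
          (g.κ.hom.app (f.F.obj X) ⊗ₘ g.κ.hom.app (f.F.obj Y)) ≫ μ W.U _ _ ≫
            W.U.map (μ g.F _ _) :=
        NatTrans.IsMonoidal.tensor (τ := g.κ.hom) (f.F.obj X) (f.F.obj Y)
      have h3 : g.G.map (V.U.map (μ f.F X Y)) ≫ g.κ.hom.app (f.F.obj (X ⊗ Y)) =
        g.κ.hom.app (f.F.obj X ⊗ f.F.obj Y) ≫ W.U.map (g.F.map (μ f.F X Y)) :=
          g.κ.hom.naturality (μ f.F X Y)
      change ((μ g.G _ _ ≫ g.G.map (μ f.G _ _)) ≫ g.G.map (f.G.map (μ U.U X Y))) ≫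
          g.G.map (f.κ.hom.app (X ⊗ Y)) ≫ g.κ.hom.app (f.F.obj (X ⊗ Y)) =
        ((g.G.map (f.κ.hom.app X) ≫ g.κ.hom.app (f.F.obj X)) ⊗ₘ
          (g.G.map (f.κ.hom.app Y) ≫ g.κ.hom.app (f.F.obj Y))) ≫
          μ W.U _ _ ≫ W.U.map (μ g.F _ _ ≫ g.F.map (μ f.F X Y))
      have h1' := congrArg g.G.map h1
      rw [← tensorHom_comp_tensorHom]
      simp only [Functor.map_comp, Category.assoc] at h1' h2 ⊢
      rw [reassoc_of% h1', h3, reassoc_of% (μ_natural g.G (f.κ.hom.app X) (f.κ.hom.app Y)).symm]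
      rw [reassoc_of% h2]

instance : CategoryStruct LMFunc.{v, u} where
  Hom := Hom₁
  id := id₁
  comp := comp₁

instance homCategory (U V : LMFunc.{v, u}) : Category (U ⟶ V) where
  Hom f g := Hom₂ f g
  id f := { θ := 𝟙 f.F, ν := 𝟙 f.G, comm := by simp }
  comp x y :=
    { θ := x.θ ≫ y.θ
      ν := x.ν ≫ y.ν
      comm := fun a => by
        rw [NatTrans.comp_app, NatTrans.comp_app, Functor.map_comp, reassoc_of% x.comm a,
          y.comm a, Category.assoc] }
  id_comp _ := Hom₂.ext (Category.id_comp _) (Category.id_comp _)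
  comp_id _ := Hom₂.ext (Category.comp_id _) (Category.comp_id _)
  assoc _ _ _ := Hom₂.ext (Category.assoc _ _ _) (Category.assoc _ _ _)

@[simp] theorem id_θ {U V : LMFunc.{v, u}} (f : U ⟶ V) : Hom₂.θ (𝟙 f) = 𝟙 f.F := rfl
@[simp] theorem id_ν {U V : LMFunc.{v, u}} (f : U ⟶ V) : Hom₂.ν (𝟙 f) = 𝟙 f.G := rfl
@[simp] theorem comp_θ {U V : LMFunc.{v, u}} {f g h : U ⟶ V} (x : f ⟶ g) (y : g ⟶ h) :
    Hom₂.θ (x ≫ y) = Hom₂.θ x ≫ Hom₂.θ y := rfl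
@[simp] theorem comp_ν {U V : LMFunc.{v, u}} {f g h : U ⟶ V} (x : f ⟶ g) (y : g ⟶ h) :
    Hom₂.ν (x ≫ y) = Hom₂.ν x ≫ Hom₂.ν y := rfl

theorem eqToHom_θ {U V : LMFunc.{v, u}} {f g : U ⟶ V} (h : f = g) :
    Hom₂.θ (eqToHom h) = eqToHom (congrArg Hom₁.F h) := by
  subst h
  rfl

theorem eqToHom_ν {U V : LMFunc.{v, u}} {f g : U ⟶ V} (h : f = g) :
    Hom₂.ν (eqToHom h) = eqToHom (congrArg Hom₁.G h) := by
  subst h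
  rfl

theorem hom₂_ext {U V : LMFunc.{v, u}} {f g : U ⟶ V} {x y : f ⟶ g}
    (h : ∀ a, (Hom₂.θ x).app a = (Hom₂.θ y).app a)
    (k : ∀ a, (Hom₂.ν x).app a = (Hom₂.ν y).app a) : x = y :=
  Hom₂.ext (NatTrans.ext (funext h)) (NatTrans.ext (funext k))

/-- Invertible 2-cells from invertible monoidal transformations. -/
def isoMk {U V : LMFunc.{v, u}} {f g : U ⟶ V} (θ : f.F ≅ g.F) (ν : f.G ≅ g.G)
    (hθ : NatTrans.IsMonoidal θ.hom) (hν : NatTrans.IsMonoidal ν.hom)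
    (comm : ∀ a : U.dom,
      f.κ.hom.app a ≫ V.U.map (θ.hom.app a) = ν.hom.app (U.U.obj a) ≫ g.κ.hom.app a) :
    f ≅ g where
  hom := { θ := θ.hom, ν := ν.hom, comm := comm }
  inv :=
    { θ := θ.inv
      ν := ν.inv
      comm := fun a => by
        rw [← cancel_epi (ν.hom.app (U.U.obj a)), ← reassoc_of% comm a, ← Functor.map_comp]
        simp }
  hom_inv_id := Hom₂.ext θ.hom_inv_id ν.hom_inv_id
  inv_hom_id := Hom₂.ext θ.inv_hom_id ν.inv_hom_id

/-- Left whiskering, componentwise. -/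
def whiskerL {U V W : LMFunc.{v, u}} (f : U ⟶ V) {g h : V ⟶ W} (x : g ⟶ h) : f ≫ g ⟶ f ≫ h where
  θ := Functor.whiskerLeft f.F (Hom₂.θ x)
  ν := Functor.whiskerLeft f.G (Hom₂.ν x)
  monθ := inferInstanceAs (NatTrans.IsMonoidal (Functor.whiskerLeft f.F (Hom₂.θ x)))
  monν := inferInstanceAs (NatTrans.IsMonoidal (Functor.whiskerLeft f.G (Hom₂.ν x)))
  comm := fun a => by
    change (g.G.map (f.κ.hom.app a) ≫ g.κ.hom.app (f.F.obj a)) ≫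
        W.U.map ((Hom₂.θ x).app (f.F.obj a)) =
      (Hom₂.ν x).app (f.G.obj (U.U.obj a)) ≫ h.G.map (f.κ.hom.app a) ≫ h.κ.hom.app (f.F.obj a)
    have e : g.G.map (f.κ.hom.app a) ≫ (Hom₂.ν x).app (V.U.obj (f.F.obj a)) =
      (Hom₂.ν x).app (f.G.obj (U.U.obj a)) ≫ h.G.map (f.κ.hom.app a) := (Hom₂.ν x).naturality _
    rw [Category.assoc, Hom₂.comm, reassoc_of% e]

/-- Right whiskering, componentwise. -/
def whiskerR {U V W : LMFunc.{v, u}} {f g : U ⟶ V} (x : f ⟶ g) (h : V ⟶ W) : f ≫ h ⟶ g ≫ h where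
  θ := Functor.whiskerRight (Hom₂.θ x) h.F
  ν := Functor.whiskerRight (Hom₂.ν x) h.G
  monθ := inferInstanceAs (NatTrans.IsMonoidal (Functor.whiskerRight (Hom₂.θ x) h.F))
  monν := inferInstanceAs (NatTrans.IsMonoidal (Functor.whiskerRight (Hom₂.ν x) h.G))
  comm := fun a => by
    change (h.G.map (f.κ.hom.app a) ≫ h.κ.hom.app (f.F.obj a)) ≫
        W.U.map (h.F.map ((Hom₂.θ x).app a)) =
      h.G.map ((Hom₂.ν x).app (U.U.obj a)) ≫ h.G.map (g.κ.hom.app a) ≫ h.κ.hom.app (g.F.obj a)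
    have e : h.G.map (V.U.map ((Hom₂.θ x).app a)) ≫ h.κ.hom.app (g.F.obj a) =
      h.κ.hom.app (f.F.obj a) ≫ W.U.map (h.F.map ((Hom₂.θ x).app a)) := h.κ.hom.naturality _
    rw [Category.assoc, ← e, ← Functor.map_comp_assoc, Hom₂.comm, Functor.map_comp_assoc]

instance bicategory : Bicategory LMFunc.{v, u} where
  homCategory := homCategory
  whiskerLeft := whiskerL
  whiskerRight := whiskerR
  associator {_ _ _ Z} f g h := isoMk (Functor.associator f.F g.F h.F) (Functor.associator f.G g.G h.G)
    (inferInstanceAs (NatTrans.IsMonoidal (Functor.associator f.F g.F h.F).hom))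
    (inferInstanceAs (NatTrans.IsMonoidal (Functor.associator f.G g.G h.G).hom)) (fun a => by
      change (h.G.map (g.G.map (f.κ.hom.app a) ≫ g.κ.hom.app (f.F.obj a)) ≫
        h.κ.hom.app (g.F.obj (f.F.obj a))) ≫ Z.U.map (𝟙 _) = 𝟙 _ ≫ (h.G.map (g.G.map (f.κ.hom.app a)) ≫
        h.G.map (g.κ.hom.app (f.F.obj a)) ≫ h.κ.hom.app (g.F.obj (f.F.obj a)))
      erw [CategoryTheory.Functor.map_id, Category.comp_id, Category.id_comp, Functor.map_comp,
        Category.assoc])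
  leftUnitor {_ V} f := isoMk f.F.leftUnitor f.G.leftUnitor
    (inferInstanceAs (NatTrans.IsMonoidal f.F.leftUnitor.hom))
    (inferInstanceAs (NatTrans.IsMonoidal f.G.leftUnitor.hom)) (fun a => by
      change (f.G.map (𝟙 _) ≫ f.κ.hom.app a) ≫ V.U.map (𝟙 _) = 𝟙 _ ≫ f.κ.hom.app a
      simp)
  rightUnitor {_ V} f := isoMk f.F.rightUnitor f.G.rightUnitor
    (inferInstanceAs (NatTrans.IsMonoidal f.F.rightUnitor.hom))
    (inferInstanceAs (NatTrans.IsMonoidal f.G.rightUnitor.hom)) (fun a => by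
      change (f.κ.hom.app a ≫ 𝟙 _) ≫ V.U.map (𝟙 _) = 𝟙 _ ≫ f.κ.hom.app a
      simp)
  whiskerLeft_id f g := hom₂_ext (fun _ => rfl) (fun _ => rfl)
  whiskerLeft_comp _ _ _ _ _ _ := hom₂_ext (fun _ => rfl) (fun _ => rfl)
  id_whiskerLeft _ := hom₂_ext
    (fun _ => ((Category.id_comp _).trans (Category.comp_id _)).symm)
    (fun _ => ((Category.id_comp _).trans (Category.comp_id _)).symm)
  comp_whiskerLeft _ _ _ _ _ := hom₂_ext
    (fun _ => ((Category.id_comp _).trans (Category.comp_id _)).symm)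
    (fun _ => ((Category.id_comp _).trans (Category.comp_id _)).symm)
  id_whiskerRight f g := hom₂_ext (fun _ => g.F.map_id _) (fun _ => g.G.map_id _)
  comp_whiskerRight _ _ i := hom₂_ext (fun _ => i.F.map_comp _ _) (fun _ => i.G.map_comp _ _)
  whiskerRight_id _ := hom₂_ext
    (fun _ => ((Category.id_comp _).trans (Category.comp_id _)).symm)
    (fun _ => ((Category.id_comp _).trans (Category.comp_id _)).symm)
  whiskerRight_comp _ _ _ := hom₂_ext
    (fun _ => ((Category.id_comp _).trans (Category.comp_id _)).symm)
    (fun _ => ((Category.id_comp _).trans (Category.comp_id _)).symm)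
  whisker_assoc _ _ _ _ _ := hom₂_ext
    (fun _ => ((Category.id_comp _).trans (Category.comp_id _)).symm)
    (fun _ => ((Category.id_comp _).trans (Category.comp_id _)).symm)
  whisker_exchange x y := hom₂_ext
    (fun a => ((Hom₂.θ y).naturality ((Hom₂.θ x).app a)).symm)
    (fun a => ((Hom₂.ν y).naturality ((Hom₂.ν x).app a)).symm)
  pentagon f g h i := hom₂_ext
    (fun _ => by
      change i.F.map (𝟙 _) ≫ 𝟙 _ ≫ 𝟙 _ = 𝟙 _ ≫ 𝟙 _
      simp)
    (fun _ => by
      change i.G.map (𝟙 _) ≫ 𝟙 _ ≫ 𝟙 _ = 𝟙 _ ≫ 𝟙 _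
      simp)
  triangle f g := hom₂_ext
    (fun _ => by
      change 𝟙 _ ≫ 𝟙 _ = g.F.map (𝟙 _)
      simp)
    (fun _ => by
      change 𝟙 _ ≫ 𝟙 _ = g.G.map (𝟙 _)
      simp)

theorem id_comp' {U V : LMFunc.{v, u}} (f : U ⟶ V) : 𝟙 U ≫ f = f :=
  Hom₁.mk_congr
    (Functor.LaxMonoidal.ext (by
      change ε f.F ≫ f.F.map (𝟙 _) = ε f.F; simp) (by
      funext X Y
      change μ f.F X Y ≫ f.F.map (𝟙 _) = μ f.F X Y; simp))
    (Functor.LaxMonoidal.ext (by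
      change ε f.G ≫ f.G.map (𝟙 _) = ε f.G; simp) (by
      funext X Y
      change μ f.G X Y ≫ f.G.map (𝟙 _) = μ f.G X Y; simp))
    (Iso.ext (NatTrans.ext (funext fun a => by
      change f.G.map (𝟙 _) ≫ f.κ.hom.app a = f.κ.hom.app a; simp)))

theorem comp_id' {U V : LMFunc.{v, u}} (f : U ⟶ V) : f ≫ 𝟙 V = f :=
  Hom₁.mk_congr
    (Functor.LaxMonoidal.ext (Category.id_comp _) (by
      funext X Y; exact Category.id_comp _))
    (Functor.LaxMonoidal.ext (Category.id_comp _) (by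
      funext X Y; exact Category.id_comp _))
    (Iso.ext (NatTrans.ext (funext fun a => by
      change f.κ.hom.app a ≫ 𝟙 _ = f.κ.hom.app a; simp)))

theorem assoc' {U V W Z : LMFunc.{v, u}} (f : U ⟶ V) (g : V ⟶ W) (h : W ⟶ Z) :
    (f ≫ g) ≫ h = f ≫ g ≫ h :=
  Hom₁.mk_congr
    (Functor.LaxMonoidal.ext (by
      change ε h.F ≫ h.F.map (ε g.F ≫ g.F.map (ε f.F)) =
        (ε h.F ≫ h.F.map (ε g.F)) ≫ h.F.map (g.F.map (ε f.F)); simp) (by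
      funext X Y
      change μ h.F _ _ ≫ h.F.map (μ g.F _ _ ≫ g.F.map (μ f.F X Y)) =
        (μ h.F _ _ ≫ h.F.map (μ g.F _ _)) ≫ h.F.map (g.F.map (μ f.F X Y)); simp))
    (Functor.LaxMonoidal.ext (by
      change ε h.G ≫ h.G.map (ε g.G ≫ g.G.map (ε f.G)) =
        (ε h.G ≫ h.G.map (ε g.G)) ≫ h.G.map (g.G.map (ε f.G)); simp) (by
      funext X Y
      change μ h.G _ _ ≫ h.G.map (μ g.G _ _ ≫ g.G.map (μ f.G X Y)) =
        (μ h.G _ _ ≫ h.G.map (μ g.G _ _)) ≫ h.G.map (g.G.map (μ f.G X Y)); simp))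
    (Iso.ext (NatTrans.ext (funext fun a => by
      change h.G.map (g.G.map (f.κ.hom.app a) ≫ g.κ.hom.app (f.F.obj a)) ≫
        h.κ.hom.app (g.F.obj (f.F.obj a)) = h.G.map (g.G.map (f.κ.hom.app a)) ≫
        h.G.map (g.κ.hom.app (f.F.obj a)) ≫ h.κ.hom.app (g.F.obj (f.F.obj a))
      simp)))

instance : Bicategory.Strict LMFunc.{v, u} where
  id_comp := id_comp'
  comp_id := comp_id'
  assoc := assoc'
  leftUnitor_eqToIso f := Iso.ext (Hom₂.ext (eqToHom_θ (id_comp' f)).symm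
    (eqToHom_ν (id_comp' f)).symm)
  rightUnitor_eqToIso f := Iso.ext (Hom₂.ext (eqToHom_θ (comp_id' f)).symm
    (eqToHom_ν (comp_id' f)).symm)
  associator_eqToIso f g h := Iso.ext (Hom₂.ext (eqToHom_θ (assoc' f g h)).symm
    (eqToHom_ν (assoc' f g h)).symm)

end LMFunc

/-- Given lax monoidal functors `G`, `H` and lax comonoidal functors `R`, `S`, a natural
transformation `φ : SG ⟶ HR` is ambimonoidal if it is compatible with these structures in the
following sense. -/
structure IsAmbimonoidal {M N M' N' : Type u} [Category.{v} M] [Category.{v} N] [Category.{v} M']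
    [Category.{v} N'] [MonoidalCategory M] [MonoidalCategory N] [MonoidalCategory M']
    [MonoidalCategory N'] {G : M ⥤ N} {H : M' ⥤ N'} {R : M ⥤ M'} {S : N ⥤ N'}
    [G.LaxMonoidal] [H.LaxMonoidal] [R.OplaxMonoidal] [S.OplaxMonoidal]
    (φ : G ⋙ S ⟶ R ⋙ H) : Prop where
  tensor (X Y : M) : S.map (μ G X Y) ≫ φ.app (X ⊗ Y) ≫ H.map (δ R X Y) =
    δ S (G.obj X) (G.obj Y) ≫ (φ.app X ⊗ₘ φ.app Y) ≫ μ H (R.obj X) (R.obj Y)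
  unit : S.map (ε G) ≫ φ.app (𝟙_ M) ≫ H.map (η R) = η S ≫ ε H

/-- An object of the 2-category `Bmd`: a monoidal category with a bimonad on it. -/
structure Bmd where
  carrier : Type u
  [cat : Category.{v} carrier]
  [mon : MonoidalCategory carrier]
  T : Monad carrier
  [bimonad : Bimonad T]

namespace Bmd

attribute [instance] cat mon bimonad

/-- A 1-cell `(M, R) ⟶ (N, S)` of `Bmd`: a lax monoidal functor `G : M ⥤ N` together with an
ambimonoidal natural transformation `φ : SG ⟶ GR` such that `(G, φ)` is a morphism of monads. -/
structure Hom₁ (X Y : Bmd.{v, u}) where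
  G : X.carrier ⥤ Y.carrier
  [laxG : G.LaxMonoidal]
  φ : G ⋙ Y.T.toFunctor ⟶ X.T.toFunctor ⋙ G
  mul : ∀ x : X.carrier, Y.T.μ.app (G.obj x) ≫ φ.app x =
    Y.T.map (φ.app x) ≫ φ.app (X.T.obj x) ≫ G.map (X.T.μ.app x)
  unit : ∀ x : X.carrier, Y.T.η.app (G.obj x) ≫ φ.app x = G.map (X.T.η.app x)
  ambi : IsAmbimonoidal φ

attribute [instance] Hom₁.laxG

theorem Hom₁.mk_congr {X Y : Bmd.{v, u}} {G : X.carrier ⥤ Y.carrier} {l l' : G.LaxMonoidal}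
    {φ φ' : G ⋙ Y.T.toFunctor ⟶ X.T.toFunctor ⋙ G} {h1 h1' h2 h2' h3 h3'}
    (hl : l = l') (hφ : φ = φ') :
    @Hom₁.mk X Y G l φ h1 h2 h3 = @Hom₁.mk X Y G l' φ' h1' h2' h3' := by
  subst hl hφ
  rfl

/-- A 2-cell `(G, φ) ⟶ (G', φ')` of `Bmd`: a monoidal natural transformation `ν : G ⟶ G'` with
`νR ∘ φ = φ' ∘ Sν`. -/
@[ext]
structure Hom₂ {X Y : Bmd.{v, u}} (f g : Hom₁ X Y) where
  ν : f.G ⟶ g.G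
  [monν : NatTrans.IsMonoidal ν]
  comm : ∀ x : X.carrier,
    f.φ.app x ≫ ν.app (X.T.obj x) = Y.T.map (ν.app x) ≫ g.φ.app x

attribute [instance] Hom₂.monν

/-- The identity 1-cell. -/
def id₁ (X : Bmd.{v, u}) : Hom₁ X X where
  G := 𝟭 _
  φ := { app := fun x => 𝟙 (X.T.obj x) }
  mul x := by
    change X.T.μ.app x ≫ 𝟙 _ = X.T.map (𝟙 _) ≫ 𝟙 _ ≫ X.T.μ.app x
    simp
  unit x := Category.comp_id _
  ambi :=
    { tensor := fun x y => by
        change X.T.map (𝟙 _) ≫ 𝟙 _ ≫ δ X.T.toFunctor x y = δ X.T.toFunctor x y ≫ (𝟙 _ ⊗ₘ 𝟙 _) ≫ 𝟙 _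
        simp
      unit := by
        change X.T.map (𝟙 _) ≫ 𝟙 _ ≫ η X.T.toFunctor = η X.T.toFunctor ≫ 𝟙 _
        simp }

/-- The composite of 1-cells: `⟨I, χ⟩ ⋄ ⟨G, φ⟩ = ⟨IG, Iφ ∘ χG⟩`. -/
def comp₁ {X Y Z : Bmd.{v, u}} (f : Hom₁ X Y) (g : Hom₁ Y Z) : Hom₁ X Z where
  G := f.G ⋙ g.G
  φ :=
    { app := fun x => g.φ.app (f.G.obj x) ≫ g.G.map (f.φ.app x)
      naturality := fun x y t => by
        have h1 : Y.T.map (f.G.map t) ≫ f.φ.app y = f.φ.app x ≫ f.G.map (X.T.map t) :=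
          f.φ.naturality t
        have h2 : Z.T.map (g.G.map (f.G.map t)) ≫ g.φ.app (f.G.obj y) =
          g.φ.app (f.G.obj x) ≫ g.G.map (Y.T.map (f.G.map t)) := g.φ.naturality (f.G.map t)
        change Z.T.map (g.G.map (f.G.map t)) ≫ g.φ.app (f.G.obj y) ≫ g.G.map (f.φ.app y) =
          (g.φ.app (f.G.obj x) ≫ g.G.map (f.φ.app x)) ≫ g.G.map (f.G.map (X.T.map t))
        rw [reassoc_of% h2, ← Functor.map_comp, h1, Functor.map_comp, Category.assoc] }
  mul x := by
    have h1 := congrArg g.G.map (f.mul x)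
    have h2 := g.mul (f.G.obj x)
    have h3 : Z.T.map (g.G.map (f.φ.app x)) ≫ g.φ.app (f.G.obj (X.T.obj x)) =
      g.φ.app (Y.T.obj (f.G.obj x)) ≫ g.G.map (Y.T.map (f.φ.app x)) := g.φ.naturality (f.φ.app x)
    change Z.T.μ.app (g.G.obj (f.G.obj x)) ≫ g.φ.app (f.G.obj x) ≫ g.G.map (f.φ.app x) =
      Z.T.map (g.φ.app (f.G.obj x) ≫ g.G.map (f.φ.app x)) ≫
      (g.φ.app (f.G.obj (X.T.obj x)) ≫ g.G.map (f.φ.app (X.T.obj x))) ≫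
      g.G.map (f.G.map (X.T.μ.app x))
    simp only [Functor.map_comp, Category.assoc] at h1 ⊢
    rw [reassoc_of% h2, h1, reassoc_of% h3]
  unit x := by
    change Z.T.η.app (g.G.obj (f.G.obj x)) ≫ g.φ.app (f.G.obj x) ≫ g.G.map (f.φ.app x) =
      g.G.map (f.G.map (X.T.η.app x))
    rw [reassoc_of% g.unit (f.G.obj x), ← Functor.map_comp, f.unit]
  ambi :=
    { tensor := fun x y => by
        have h1 := congrArg g.G.map (f.ambi.tensor x y)
        have h2 := g.ambi.tensor (f.G.obj x) (f.G.obj y)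
        have h3 : Z.T.map (g.G.map (μ f.G x y)) ≫ g.φ.app (f.G.obj (x ⊗ y)) =
          g.φ.app (f.G.obj x ⊗ f.G.obj y) ≫ g.G.map (Y.T.map (μ f.G x y)) :=
            g.φ.naturality (μ f.G x y)
        change Z.T.map (μ g.G _ _ ≫ g.G.map (μ f.G x y)) ≫
            (g.φ.app (f.G.obj (x ⊗ y)) ≫ g.G.map (f.φ.app (x ⊗ y))) ≫
            g.G.map (f.G.map (δ X.T.toFunctor x y)) =
          δ Z.T.toFunctor _ _ ≫ ((g.φ.app (f.G.obj x) ≫ g.G.map (f.φ.app x)) ⊗ₘ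
            (g.φ.app (f.G.obj y) ≫ g.G.map (f.φ.app y))) ≫ μ g.G _ _ ≫ g.G.map (μ f.G _ _)
        rw [← tensorHom_comp_tensorHom]
        simp only [Functor.map_comp, Category.assoc] at h1 h2 ⊢
        rw [reassoc_of% h3, h1, reassoc_of% h2, μ_natural_assoc]
      unit := by
        have h1 := congrArg g.G.map f.ambi.unit
        have h2 := g.ambi.unit
        have h3 : Z.T.map (g.G.map (ε f.G)) ≫ g.φ.app (f.G.obj (𝟙_ _)) =
          g.φ.app (𝟙_ _) ≫ g.G.map (Y.T.map (ε f.G)) := g.φ.naturality (ε f.G)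
        change Z.T.map (ε g.G ≫ g.G.map (ε f.G)) ≫
            (g.φ.app (f.G.obj (𝟙_ _)) ≫ g.G.map (f.φ.app (𝟙_ _))) ≫
            g.G.map (f.G.map (η X.T.toFunctor)) =
          η Z.T.toFunctor ≫ ε g.G ≫ g.G.map (ε f.G)
        simp only [Functor.map_comp, Category.assoc] at h1 h2 ⊢
        rw [reassoc_of% h3, h1, reassoc_of% h2] }

instance : CategoryStruct Bmd.{v, u} where
  Hom := Hom₁
  id := id₁
  comp := comp₁

instance homCategory (X Y : Bmd.{v, u}) : Category (X ⟶ Y) where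
  Hom f g := Hom₂ f g
  id f := { ν := 𝟙 f.G, comm := by simp }
  comp x y :=
    { ν := x.ν ≫ y.ν
      comm := fun a => by
        rw [NatTrans.comp_app, NatTrans.comp_app, Functor.map_comp, reassoc_of% x.comm a,
          y.comm a, Category.assoc] }
  id_comp _ := Hom₂.ext (Category.id_comp _)
  comp_id _ := Hom₂.ext (Category.comp_id _)
  assoc _ _ _ := Hom₂.ext (Category.assoc _ _ _)

theorem comp_ν {X Y : Bmd.{v, u}} {f g h : X ⟶ Y} (x : f ⟶ g) (y : g ⟶ h) :
    Hom₂.ν (x ≫ y) = Hom₂.ν x ≫ Hom₂.ν y := rfl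

theorem eqToHom_ν {X Y : Bmd.{v, u}} {f g : X ⟶ Y} (h : f = g) :
    Hom₂.ν (eqToHom h) = eqToHom (congrArg Hom₁.G h) := by
  subst h
  rfl

theorem hom₂_ext {X Y : Bmd.{v, u}} {f g : X ⟶ Y} {x y : f ⟶ g}
    (k : ∀ a, (Hom₂.ν x).app a = (Hom₂.ν y).app a) : x = y :=
  Hom₂.ext (NatTrans.ext (funext k))

/-- Invertible 2-cells from invertible monoidal transformations. -/
def isoMk {X Y : Bmd.{v, u}} {f g : X ⟶ Y} (ν : f.G ≅ g.G) (hν : NatTrans.IsMonoidal ν.hom)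
    (comm : ∀ x : X.carrier,
      f.φ.app x ≫ ν.hom.app (X.T.obj x) = Y.T.map (ν.hom.app x) ≫ g.φ.app x) :
    f ≅ g where
  hom := { ν := ν.hom, comm := comm }
  inv :=
    { ν := ν.inv
      comm := fun a => by
        rw [← cancel_epi (Y.T.map (ν.hom.app a)), ← reassoc_of% comm a, ← Functor.map_comp_assoc]
        simp }
  hom_inv_id := Hom₂.ext ν.hom_inv_id
  inv_hom_id := Hom₂.ext ν.inv_hom_id

/-- Left whiskering. -/
def whiskerL {X Y Z : Bmd.{v, u}} (f : X ⟶ Y) {g h : Y ⟶ Z} (x : g ⟶ h) : f ≫ g ⟶ f ≫ h where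
  ν := Functor.whiskerLeft f.G (Hom₂.ν x)
  monν := inferInstanceAs (NatTrans.IsMonoidal (Functor.whiskerLeft f.G (Hom₂.ν x)))
  comm := fun a => by
    change (g.φ.app (f.G.obj a) ≫ g.G.map (f.φ.app a)) ≫
        (Hom₂.ν x).app (f.G.obj (X.T.obj a)) =
      Z.T.map ((Hom₂.ν x).app (f.G.obj a)) ≫ h.φ.app (f.G.obj a) ≫ h.G.map (f.φ.app a)
    have e : g.G.map (f.φ.app a) ≫ (Hom₂.ν x).app (f.G.obj (X.T.obj a)) =
      (Hom₂.ν x).app (Y.T.obj (f.G.obj a)) ≫ h.G.map (f.φ.app a) := (Hom₂.ν x).naturality _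
    rw [Category.assoc, e, reassoc_of% Hom₂.comm x (f.G.obj a)]

/-- Right whiskering. -/
def whiskerR {X Y Z : Bmd.{v, u}} {f g : X ⟶ Y} (x : f ⟶ g) (h : Y ⟶ Z) : f ≫ h ⟶ g ≫ h where
  ν := Functor.whiskerRight (Hom₂.ν x) h.G
  monν := inferInstanceAs (NatTrans.IsMonoidal (Functor.whiskerRight (Hom₂.ν x) h.G))
  comm := fun a => by
    change (h.φ.app (f.G.obj a) ≫ h.G.map (f.φ.app a)) ≫
        h.G.map ((Hom₂.ν x).app (X.T.obj a)) =
      Z.T.map (h.G.map ((Hom₂.ν x).app a)) ≫ h.φ.app (g.G.obj a) ≫ h.G.map (g.φ.app a)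
    have e : Z.T.map (h.G.map ((Hom₂.ν x).app a)) ≫ h.φ.app (g.G.obj a) =
      h.φ.app (f.G.obj a) ≫ h.G.map (Y.T.map ((Hom₂.ν x).app a)) := h.φ.naturality _
    rw [Category.assoc, reassoc_of% e, ← Functor.map_comp, Hom₂.comm, Functor.map_comp]

instance bicategory : Bicategory Bmd.{v, u} where
  homCategory := homCategory
  whiskerLeft := whiskerL
  whiskerRight := whiskerR
  associator {_ _ _ Z} f g h := isoMk (Functor.associator f.G g.G h.G)
    (inferInstanceAs (NatTrans.IsMonoidal (Functor.associator f.G g.G h.G).hom)) (fun a => by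
      change (h.φ.app (g.G.obj (f.G.obj a)) ≫
          h.G.map (g.φ.app (f.G.obj a) ≫ g.G.map (f.φ.app a))) ≫ 𝟙 _ =
        Z.T.map (𝟙 _) ≫ (h.φ.app (g.G.obj (f.G.obj a)) ≫ h.G.map (g.φ.app (f.G.obj a))) ≫
          h.G.map (g.G.map (f.φ.app a))
      simp)
  leftUnitor {_ Y} f := isoMk f.G.leftUnitor
    (inferInstanceAs (NatTrans.IsMonoidal f.G.leftUnitor.hom)) (fun a => by
      change (f.φ.app a ≫ f.G.map (𝟙 _)) ≫ 𝟙 _ = Y.T.map (𝟙 _) ≫ f.φ.app a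
      simp)
  rightUnitor {_ Y} f := isoMk f.G.rightUnitor
    (inferInstanceAs (NatTrans.IsMonoidal f.G.rightUnitor.hom)) (fun a => by
      change (𝟙 _ ≫ f.φ.app a) ≫ 𝟙 _ = Y.T.map (𝟙 _) ≫ f.φ.app a
      simp)
  whiskerLeft_id f g := hom₂_ext (fun _ => rfl)
  whiskerLeft_comp _ _ _ _ _ _ := hom₂_ext (fun _ => rfl)
  id_whiskerLeft _ := hom₂_ext (fun _ => ((Category.id_comp _).trans (Category.comp_id _)).symm)
  comp_whiskerLeft _ _ _ _ _ := hom₂_ext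
    (fun _ => ((Category.id_comp _).trans (Category.comp_id _)).symm)
  id_whiskerRight f g := hom₂_ext (fun _ => g.G.map_id _)
  comp_whiskerRight _ _ i := hom₂_ext (fun _ => i.G.map_comp _ _)
  whiskerRight_id _ := hom₂_ext (fun _ => ((Category.id_comp _).trans (Category.comp_id _)).symm)
  whiskerRight_comp _ _ _ := hom₂_ext
    (fun _ => ((Category.id_comp _).trans (Category.comp_id _)).symm)
  whisker_assoc _ _ _ _ _ := hom₂_ext
    (fun _ => ((Category.id_comp _).trans (Category.comp_id _)).symm)
  whisker_exchange x y := hom₂_ext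
    (fun a => ((Hom₂.ν y).naturality ((Hom₂.ν x).app a)).symm)
  pentagon f g h i := hom₂_ext (fun _ => by
    change i.G.map (𝟙 _) ≫ 𝟙 _ ≫ 𝟙 _ = 𝟙 _ ≫ 𝟙 _
    simp)
  triangle f g := hom₂_ext (fun _ => by
    change 𝟙 _ ≫ 𝟙 _ = g.G.map (𝟙 _)
    simp)

theorem id_comp' {X Y : Bmd.{v, u}} (f : X ⟶ Y) : 𝟙 X ≫ f = f :=
  Hom₁.mk_congr
    (Functor.LaxMonoidal.ext (by
      change ε f.G ≫ f.G.map (𝟙 _) = ε f.G; simp) (by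
      funext x y
      change μ f.G x y ≫ f.G.map (𝟙 _) = μ f.G x y; simp))
    (NatTrans.ext (funext fun a => by
      change f.φ.app a ≫ f.G.map (𝟙 _) = f.φ.app a; simp))

theorem comp_id' {X Y : Bmd.{v, u}} (f : X ⟶ Y) : f ≫ 𝟙 Y = f :=
  Hom₁.mk_congr
    (Functor.LaxMonoidal.ext (Category.id_comp _) (by
      funext x y; exact Category.id_comp _))
    (NatTrans.ext (funext fun a => Category.id_comp _))

theorem assoc' {X Y Z W : Bmd.{v, u}} (f : X ⟶ Y) (g : Y ⟶ Z) (h : Z ⟶ W) :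
    (f ≫ g) ≫ h = f ≫ g ≫ h :=
  Hom₁.mk_congr
    (Functor.LaxMonoidal.ext (by
      change ε h.G ≫ h.G.map (ε g.G ≫ g.G.map (ε f.G)) =
        (ε h.G ≫ h.G.map (ε g.G)) ≫ h.G.map (g.G.map (ε f.G)); simp) (by
      funext x y
      change μ h.G _ _ ≫ h.G.map (μ g.G _ _ ≫ g.G.map (μ f.G x y)) =
        (μ h.G _ _ ≫ h.G.map (μ g.G _ _)) ≫ h.G.map (g.G.map (μ f.G x y)); simp))
    (NatTrans.ext (funext fun a => by
      change h.φ.app (g.G.obj (f.G.obj a)) ≫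
          h.G.map (g.φ.app (f.G.obj a) ≫ g.G.map (f.φ.app a)) =
        (h.φ.app (g.G.obj (f.G.obj a)) ≫ h.G.map (g.φ.app (f.G.obj a))) ≫
          h.G.map (g.G.map (f.φ.app a))
      simp))

instance : Bicategory.Strict Bmd.{v, u} where
  id_comp := id_comp'
  comp_id := comp_id'
  assoc := assoc'
  leftUnitor_eqToIso f := Iso.ext (Hom₂.ext (eqToHom_ν (id_comp' f)).symm)
  rightUnitor_eqToIso f := Iso.ext (Hom₂.ext (eqToHom_ν (comp_id' f)).symm)
  associator_eqToIso f g h := Iso.ext (Hom₂.ext (eqToHom_ν (assoc' f g h)).symm)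

end Bmd

namespace Bmd

/-- The lax monoidal functor into the category of algebras determined by a lax monoidal functor
`K` into the base category together with a compatible action `a : TK ⟶ K`. -/
def liftAlg {A N : Type*} [Category* A] [Category* N] {T : Monad N} (K : A ⥤ N)
    (a : K ⋙ T.toFunctor ⟶ K)
    (unit : ∀ x, T.η.app (K.obj x) ≫ a.app x = 𝟙 _)
    (assoc : ∀ x, T.μ.app (K.obj x) ≫ a.app x = T.map (a.app x) ≫ a.app x) : A ⥤ T.Algebra where
  obj x := { A := K.obj x, a := a.app x, unit := unit x, assoc := assoc x }
  map f := { f := K.map f, h := a.naturality f }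
  map_id x := by ext; exact K.map_id x
  map_comp f g := by ext; exact K.map_comp f g

/-- The functor `G^φ : M^T ⥤ N^S`, `⟨x, α⟩ ↦ ⟨Gx, Gα ∘ φ_x⟩`, induced by a 1-cell of `Bmd`. -/
def algFunctor {X Y : Bmd.{v, u}} (f : X ⟶ Y) : X.T.Algebra ⥤ Y.T.Algebra where
  obj x :=
    { A := f.G.obj x.A
      a := f.φ.app x.A ≫ f.G.map x.a
      unit := by rw [reassoc_of% f.unit x.A, ← Functor.map_comp, x.unit, f.G.map_id]
      assoc := by
        have e : Y.T.map (f.G.map x.a) ≫ f.φ.app x.A =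
          f.φ.app (X.T.obj x.A) ≫ f.G.map (X.T.map x.a) := f.φ.naturality x.a
        rw [reassoc_of% f.mul x.A, ← Functor.map_comp, x.assoc, Functor.map_comp,
          Functor.map_comp, Category.assoc, reassoc_of% e] }
  map {x y} t :=
    { f := f.G.map t.f
      h := by
        have e : Y.T.map (f.G.map t.f) ≫ f.φ.app y.A =
          f.φ.app x.A ≫ f.G.map (X.T.map t.f) := f.φ.naturality t.f
        change Y.T.map (f.G.map t.f) ≫ f.φ.app y.A ≫ f.G.map y.a =
          (f.φ.app x.A ≫ f.G.map x.a) ≫ f.G.map t.f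
        rw [reassoc_of% e, ← Functor.map_comp, t.h, Functor.map_comp, Category.assoc] }
  map_id x := by ext; exact f.G.map_id x.A
  map_comp s t := by ext; exact f.G.map_comp s.f t.f

/-- The lax monoidal structure of `G^φ`, lifted from that of `G`. -/
instance algFunctorLax {X Y : Bmd.{v, u}} (f : X ⟶ Y) : (algFunctor f).LaxMonoidal where
  ε :=
    { f := ε f.G
      h := f.ambi.unit }
  μ x y :=
    { f := μ f.G x.A y.A
      h := by
        change Y.T.map (μ f.G x.A y.A) ≫ f.φ.app (x.A ⊗ y.A) ≫
            f.G.map (δ X.T.toFunctor x.A y.A ≫ (x.a ⊗ₘ y.a)) =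
          (δ Y.T.toFunctor _ _ ≫ ((f.φ.app x.A ≫ f.G.map x.a) ⊗ₘ (f.φ.app y.A ≫ f.G.map y.a))) ≫
            μ f.G x.A y.A
        have e := f.ambi.tensor x.A y.A
        rw [← tensorHom_comp_tensorHom, Functor.map_comp, reassoc_of% e, Category.assoc,
          Category.assoc, μ_natural] }
  μ_natural_left s y := by ext; exact μ_natural_left f.G s.f y.A
  μ_natural_right x s := by ext; exact μ_natural_right f.G x.A s.f
  associativity x y z := by ext; exact associativity f.G x.A y.A z.A
  left_unitality x := by ext; exact left_unitality f.G x.A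
  right_unitality x := by ext; exact right_unitality f.G x.A

/-- The object map of `EM`: the forgetful functor of the Eilenberg–Moore category. -/
def emObj (X : Bmd.{v, u}) : LMFunc.{v, u} where
  dom := X.T.Algebra
  cod := X.carrier
  U := X.T.forget
  hasLeftAdjoint := X.T.adj.isRightAdjoint

/-- The identity natural isomorphism `G U^T = U^S G^φ`. -/
def emκ {X Y : Bmd.{v, u}} (f : X ⟶ Y) : X.T.forget ⋙ f.G ≅ algFunctor f ⋙ Y.T.forget :=
  NatIso.ofComponents (fun x => Iso.refl (f.G.obj x.A)) (fun {x y} t => by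
    change f.G.map t.f ≫ 𝟙 _ = 𝟙 _ ≫ f.G.map t.f
    simp)

instance emκ_isMonoidal {X Y : Bmd.{v, u}} (f : X ⟶ Y) : NatTrans.IsMonoidal (emκ f).hom where
  unit := by
    change (ε f.G ≫ f.G.map (𝟙 _)) ≫ 𝟙 _ = 𝟙 _ ≫ ε f.G
    simp
  tensor x y := by
    change (μ f.G x.A y.A ≫ f.G.map (𝟙 _)) ≫ 𝟙 _ = (𝟙 _ ⊗ₘ 𝟙 _) ≫ 𝟙 _ ≫ μ f.G x.A y.A
    simp

/-- The 1-cell map of `EM`: `⟨G, φ⟩ ↦ ⟨G^φ, =, G⟩`. -/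
def emMap {X Y : Bmd.{v, u}} (f : X ⟶ Y) : emObj X ⟶ emObj Y where
  F := algFunctor f
  G := f.G
  laxF := algFunctorLax f
  laxG := f.laxG
  κ := emκ f
  monκ := emκ_isMonoidal f

/-- The 2-cell map of `EM`: `ν ↦ [ν̂, ν]` with `ν̂` the lift of `ν` to algebras. -/
def emMap₂ {X Y : Bmd.{v, u}} {f g : X ⟶ Y} (x : f ⟶ g) : emMap f ⟶ emMap g where
  θ :=
    { app := fun a =>
        { f := (Hom₂.ν x).app a.A
          h := by
            change Y.T.map ((Hom₂.ν x).app a.A) ≫ g.φ.app a.A ≫ g.G.map a.a =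
              (f.φ.app a.A ≫ f.G.map a.a) ≫ (Hom₂.ν x).app a.A
            rw [← reassoc_of% Hom₂.comm x a.A, Category.assoc, NatTrans.naturality] }
      naturality := fun a b t => by
        exact Monad.Algebra.Hom.ext ((Hom₂.ν x).naturality t.f) }
  ν := Hom₂.ν x
  monθ :=
    { unit := by
        exact Monad.Algebra.Hom.ext (NatTrans.IsMonoidal.unit (τ := Hom₂.ν x))
      tensor := fun a b => by
        exact Monad.Algebra.Hom.ext (NatTrans.IsMonoidal.tensor (τ := Hom₂.ν x) a.A b.A) }
  monν := x.monν
  comm a := by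
    change 𝟙 _ ≫ (Hom₂.ν x).app a.A = (Hom₂.ν x).app a.A ≫ 𝟙 _
    simp

theorem em_mk_congr {V : LMFunc.{v, u}} {Y : Bmd.{v, u}} {K : V.dom ⥤ Y.carrier}
    {a a' : K ⋙ Y.T.toFunctor ⟶ K} {h₁ h₂ h₁' h₂'} {G : V.cod ⥤ Y.carrier}
    {l : (liftAlg (T := Y.T) K a h₁ h₂).LaxMonoidal}
    {l' : (liftAlg (T := Y.T) K a' h₁' h₂').LaxMonoidal} {m m' : G.LaxMonoidal}
    {κ : V.U ⋙ G ≅ liftAlg (T := Y.T) K a h₁ h₂ ⋙ Y.T.forget}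
    {κ' : V.U ⋙ G ≅ liftAlg (T := Y.T) K a' h₁' h₂' ⋙ Y.T.forget} {p p'}
    (ha : ∀ x, a.app x = a'.app x) (hε : l.ε.f = l'.ε.f)
    (hμ : ∀ x y, (l.μ x y).f = (l'.μ x y).f) (hm : m = m')
    (hκ : ∀ x, κ.hom.app x = κ'.hom.app x) :
    (LMFunc.Hom₁.mk (V := emObj Y) (liftAlg (T := Y.T) K a h₁ h₂) G (laxF := l) (laxG := m) κ
      (monκ := p) :
      V ⟶ emObj Y) =
    LMFunc.Hom₁.mk (V := emObj Y) (liftAlg (T := Y.T) K a' h₁' h₂') G (laxF := l')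
      (laxG := m') κ' (monκ := p') := by
  obtain rfl : a = a' := NatTrans.ext (funext ha)
  exact LMFunc.Hom₁.mk_congr
    (Functor.LaxMonoidal.ext (Monad.Algebra.Hom.ext hε)
      (funext fun x => funext fun y => Monad.Algebra.Hom.ext (hμ x y))) hm
    (Iso.ext (NatTrans.ext (funext hκ)))

/-- The action on `G U^T` describing the functor `G^φ`. -/
def act {X Y : Bmd.{v, u}} (f : X ⟶ Y) :
    (X.T.forget ⋙ f.G) ⋙ Y.T.toFunctor ⟶ X.T.forget ⋙ f.G where
  app x := f.φ.app x.A ≫ f.G.map x.a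
  naturality _ _ t := ((algFunctor f).map t).h

/-- The tautological action on the forgetful functor. -/
def actId (X : Bmd.{v, u}) : X.T.forget ⋙ X.T.toFunctor ⟶ X.T.forget where
  app x := x.a
  naturality _ _ t := t.h

/-- The action describing a composite of functors between categories of algebras. -/
def actComp {X Y Z : Bmd.{v, u}} (f : X ⟶ Y) (g : Y ⟶ Z) :
    (X.T.forget ⋙ f.G ⋙ g.G) ⋙ Z.T.toFunctor ⟶ X.T.forget ⋙ f.G ⋙ g.G where
  app x := g.φ.app (f.G.obj x.A) ≫ g.G.map (f.φ.app x.A ≫ f.G.map x.a)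
  naturality _ _ t := ((algFunctor f ⋙ algFunctor g).map t).h

theorem emMap_id (X : Bmd.{v, u}) : emMap (𝟙 X) = 𝟙 (emObj X) :=
  em_mk_congr (V := emObj X) (Y := X) (K := X.T.forget) (a := act (𝟙 X)) (a' := actId X)
    (fun x => Category.id_comp _) rfl (fun _ _ => rfl) rfl (fun _ => rfl)

theorem emMap_comp {X Y Z : Bmd.{v, u}} (f : X ⟶ Y) (g : Y ⟶ Z) :
    emMap (f ≫ g) = emMap f ≫ emMap g :=
  em_mk_congr (V := emObj X) (Y := Z) (K := X.T.forget ⋙ f.G ⋙ g.G) (a := act (f ≫ g))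
    (a' := actComp f g)
    (fun (x : X.T.Algebra) => by
      change (g.φ.app (f.G.obj x.A) ≫ g.G.map (f.φ.app x.A)) ≫ g.G.map (f.G.map x.a) =
        g.φ.app (f.G.obj x.A) ≫ g.G.map (f.φ.app x.A ≫ f.G.map x.a)
      simp) rfl (fun _ _ => rfl) rfl (fun x => by
      change 𝟙 _ = g.G.map (𝟙 _) ≫ 𝟙 _
      simp)

theorem em_eqToHom_θ_f {V : LMFunc.{v, u}} {Y : Bmd.{v, u}} {f g : V ⟶ emObj Y} (h : f = g)
    (x : V.dom) : ((LMFunc.Hom₂.θ (eqToHom h)).app x).f =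
      eqToHom (by rw [h]) := by
  subst h
  rfl

end Bmd

/-- The 2-functor `EM : Bmd ⟶ L-MFunc`. -/
def EM : StrictPseudofunctor Bmd.{v, u} LMFunc.{v, u} :=
  StrictPseudofunctor.mk''
    { obj := Bmd.emObj
      map := Bmd.emMap
      map₂ := Bmd.emMap₂
      map₂_id := fun f => LMFunc.hom₂_ext (fun _ => Monad.Algebra.Hom.ext rfl) (fun _ => rfl)
      map₂_comp := fun x y => LMFunc.hom₂_ext (fun _ => Monad.Algebra.Hom.ext rfl) (fun _ => rfl)
      map_id := Bmd.emMap_id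
      map_comp := Bmd.emMap_comp
      map₂_whisker_left := fun {a b c} f {g h} x => LMFunc.hom₂_ext
        (fun y => Monad.Algebra.Hom.ext (by
          rw [LMFunc.comp_θ, LMFunc.comp_θ, NatTrans.comp_app, NatTrans.comp_app]
          erw [Monad.Algebra.comp_f, Monad.Algebra.comp_f, Bmd.em_eqToHom_θ_f, Bmd.em_eqToHom_θ_f]
          erw [Category.id_comp, Category.comp_id]
          rfl))
        (fun y => by
          rw [LMFunc.comp_ν, LMFunc.comp_ν, LMFunc.eqToHom_ν, LMFunc.eqToHom_ν]
          exact ((Category.id_comp _).trans (Category.comp_id _)).symm)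
      map₂_whisker_right := fun {a b c f g} x h => LMFunc.hom₂_ext
        (fun y => Monad.Algebra.Hom.ext (by
          rw [LMFunc.comp_θ, LMFunc.comp_θ, NatTrans.comp_app, NatTrans.comp_app]
          erw [Monad.Algebra.comp_f, Monad.Algebra.comp_f, Bmd.em_eqToHom_θ_f, Bmd.em_eqToHom_θ_f]
          erw [Category.id_comp, Category.comp_id]
          rfl))
        (fun y => by
          rw [LMFunc.comp_ν, LMFunc.comp_ν, LMFunc.eqToHom_ν, LMFunc.eqToHom_ν]
          exact ((Category.id_comp _).trans (Category.comp_id _)).symm) }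

section Adjunction

variable {A M : Type*} [Category* A] [MonoidalCategory A] [Category* M] [MonoidalCategory M]
  {L : M ⥤ A} {U : A ⥤ M} (adj : L ⊣ U) [U.Monoidal] [L.OplaxMonoidal] [adj.IsMonoidal]

theorem bimonad_mul_tensor (X Y : M) :
    U.map (adj.counit.app (L.obj (X ⊗ Y))) ≫ U.map (δ L X Y) ≫ δ U _ _ =
      U.map (L.map (U.map (δ L X Y) ≫ δ U _ _)) ≫
        (U.map (δ L (U.obj (L.obj X)) (U.obj (L.obj Y))) ≫ δ U _ _) ≫
        (U.map (adj.counit.app (L.obj X)) ⊗ₘ U.map (adj.counit.app (L.obj Y))) := by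
  have h := adj.map_μ_comp_counit_app_tensor (L.obj X) (L.obj Y)
  have h' : L.map (δ U (L.obj X) (L.obj Y)) ≫ δ L _ _ ≫
      (adj.counit.app (L.obj X) ⊗ₘ adj.counit.app (L.obj Y)) = adj.counit.app _ := by
    rw [← h, ← Functor.map_comp_assoc, Functor.Monoidal.δ_μ, CategoryTheory.Functor.map_id,
      Category.id_comp]
  have e : adj.counit.app (L.obj (X ⊗ Y)) ≫ δ L X Y =
      L.map (U.map (δ L X Y)) ≫ adj.counit.app _ := (adj.counit_naturality _).symm
  rw [Category.assoc, δ_natural, ← Functor.map_comp_assoc, e, ← h']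
  simp only [Functor.map_comp, Category.assoc]
  rfl

theorem bimonad_mul_unit :
    U.map (adj.counit.app (L.obj (𝟙_ M))) ≫ U.map (η L) ≫ η U =
      U.map (L.map (U.map (η L) ≫ η U)) ≫ U.map (η L) ≫ η U := by
  have h : L.map (η U) ≫ η L = adj.counit.app (𝟙_ A) := by
    rw [← adj.map_ε_comp_counit_app_unit, ← Functor.map_comp_assoc, Functor.Monoidal.η_ε,
      CategoryTheory.Functor.map_id, Category.id_comp]
  have e : adj.counit.app (L.obj (𝟙_ M)) ≫ η L =
      L.map (U.map (η L)) ≫ adj.counit.app _ := (adj.counit_naturality _).symm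
  rw [← Functor.map_comp_assoc, e, ← h]
  simp only [Functor.map_comp, Category.assoc]

end Adjunction

/-- The bimonad of a monoidal functor `U` with a left adjoint `L`: its monad is `UL`, the comonoidal
structure is the composite of those of `L` (the mate of the monoidal structure of `U`) and `U`. -/
@[reducible]
def adjBimonad {A M : Type*} [Category* A] [MonoidalCategory A] [Category* M] [MonoidalCategory M]
    {L : M ⥤ A} {U : A ⥤ M} (adj : L ⊣ U) [U.Monoidal] : Bimonad adj.toMonad :=
  letI := adj.leftAdjointOplaxMonoidal
  { toOplaxMonoidal := inferInstanceAs (L ⋙ U).OplaxMonoidal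
    mul_tensor := fun X Y => (bimonad_mul_tensor adj X Y).trans (by
      congr 1)
    mul_unit := bimonad_mul_unit adj
    unit_tensor := fun X Y => by
      change adj.unit.app (X ⊗ Y) ≫ U.map (δ L X Y) ≫ δ U _ _ = _
      rw [adj.unit_app_tensor_comp_map_δ_assoc, Functor.Monoidal.μ_δ]
      exact Category.comp_id _
    unit_unit := by
      change adj.unit.app (𝟙_ M) ≫ U.map (η L) ≫ η U = _
      rw [adj.unit_app_unit_comp_map_η_assoc, Functor.Monoidal.ε_η] }

/-- A choice of a left adjoint, with unit and counit, for each object of `L-MFunc`. -/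
structure AdjunctionChoice where
  L (U : LMFunc.{v, u}) : U.cod ⥤ U.dom
  adj (U : LMFunc.{v, u}) : L U ⊣ U.U

namespace AdjunctionChoice

variable (c : AdjunctionChoice.{v, u})

/-- The object map of `Q`. -/
@[reducible]
def qObj (U : LMFunc.{v, u}) : Bmd.{v, u} where
  carrier := U.cod
  T := (c.adj U).toMonad
  bimonad := adjBimonad (c.adj U)

/-- The unit `x ⟶ UŪx`. -/
def un (U : LMFunc.{v, u}) (x : U.cod) : x ⟶ U.U.obj ((c.L U).obj x) := (c.adj U).unit.app x

/-- The counit `ŪUa ⟶ a`. -/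
def co (U : LMFunc.{v, u}) (a : U.dom) : (c.L U).obj (U.U.obj a) ⟶ a := (c.adj U).counit.app a

theorem un_nat {U : LMFunc.{v, u}} {x y : U.cod} (t : x ⟶ y) :
    c.un U x ≫ U.U.map ((c.L U).map t) = t ≫ c.un U y := (c.adj U).unit_naturality t

theorem co_nat {U : LMFunc.{v, u}} {a b : U.dom} (t : a ⟶ b) :
    (c.L U).map (U.U.map t) ≫ c.co U b = c.co U a ≫ t := (c.adj U).counit_naturality t

theorem zigL (U : LMFunc.{v, u}) (x : U.cod) :
    (c.L U).map (c.un U x) ≫ c.co U ((c.L U).obj x) = 𝟙 _ :=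
  (c.adj U).left_triangle_components x

theorem zigR (U : LMFunc.{v, u}) (a : U.dom) :
    c.un U (U.U.obj a) ≫ U.U.map (c.co U a) = 𝟙 _ :=
  (c.adj U).right_triangle_components a

theorem hom_ext {V : LMFunc.{v, u}} {y : V.cod} {b : V.dom} {s t : (c.L V).obj y ⟶ b}
    (h : c.un V y ≫ V.U.map s = c.un V y ≫ V.U.map t) : s = t := by
  apply ((c.adj V).homEquiv y b).injective
  rw [Adjunction.homEquiv_unit, Adjunction.homEquiv_unit]
  exact h

theorem κ_nat {U V : LMFunc.{v, u}} (f : U ⟶ V) {a b : U.dom} (t : a ⟶ b) :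
    f.G.map (U.U.map t) ≫ f.κ.hom.app b = f.κ.hom.app a ≫ V.U.map (f.F.map t) :=
  f.κ.hom.naturality t

theorem κi_nat {U V : LMFunc.{v, u}} (f : U ⟶ V) {a b : U.dom} (t : a ⟶ b) :
    V.U.map (f.F.map t) ≫ f.κ.inv.app b = f.κ.inv.app a ≫ f.G.map (U.U.map t) :=
  f.κ.inv.naturality t

/-- The mate `ψ : V̄ G ⟶ F Ū` of `κ : GU ⟶ VF`. -/
def ψ {U V : LMFunc.{v, u}} (f : U ⟶ V) (x : U.cod) :
    (c.L V).obj (f.G.obj x) ⟶ f.F.obj ((c.L U).obj x) :=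
  (c.L V).map (f.G.map (c.un U x) ≫ f.κ.hom.app ((c.L U).obj x)) ≫
    c.co V (f.F.obj ((c.L U).obj x))

theorem un_ψ {U V : LMFunc.{v, u}} (f : U ⟶ V) (x : U.cod) :
    c.un V (f.G.obj x) ≫ V.U.map (c.ψ f x) =
      f.G.map (c.un U x) ≫ f.κ.hom.app ((c.L U).obj x) := by
  have e : c.un V (f.G.obj x) ≫
      V.U.map ((c.L V).map (f.G.map (c.un U x) ≫ f.κ.hom.app ((c.L U).obj x))) =
      (f.G.map (c.un U x) ≫ f.κ.hom.app ((c.L U).obj x)) ≫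
        c.un V (V.U.obj (f.F.obj ((c.L U).obj x))) := c.un_nat _
  rw [ψ, Functor.map_comp, reassoc_of% e, zigR]
  exact congrArg (fun t => _ ≫ t) (Category.comp_id _)

theorem ψ_nat {U V : LMFunc.{v, u}} (f : U ⟶ V) {x y : U.cod} (t : x ⟶ y) :
    (c.L V).map (f.G.map t) ≫ c.ψ f y = c.ψ f x ≫ f.F.map ((c.L U).map t) := by
  apply c.hom_ext
  rw [Functor.map_comp, Functor.map_comp, reassoc_of% c.un_nat (f.G.map t), un_ψ,
    reassoc_of% (c.un_ψ f x), ← κ_nat, ← Functor.map_comp_assoc, ← Functor.map_comp_assoc, un_nat]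

/-- The components of the 2-cell `φ : SG ⟶ GR` of `Q⟨F, κ, G⟩`, where `R = UŪ` and `S = VV̄`. -/
def φApp {U V : LMFunc.{v, u}} (f : U ⟶ V) (x : U.cod) :
    V.U.obj ((c.L V).obj (f.G.obj x)) ⟶ f.G.obj (U.U.obj ((c.L U).obj x)) :=
  V.U.map (c.ψ f x) ≫ f.κ.inv.app ((c.L U).obj x)

theorem φApp_nat {U V : LMFunc.{v, u}} (f : U ⟶ V) {x y : U.cod} (t : x ⟶ y) :
    V.U.map ((c.L V).map (f.G.map t)) ≫ c.φApp f y =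
      c.φApp f x ≫ f.G.map (U.U.map ((c.L U).map t)) := by
  rw [φApp, φApp, ← Functor.map_comp_assoc, ψ_nat, Functor.map_comp_assoc]
  exact (congrArg (fun t => _ ≫ t) (κi_nat f _)).trans (Category.assoc _ _ _).symm

theorem φApp_κ {U V : LMFunc.{v, u}} (f : U ⟶ V) (x : U.cod) :
    c.φApp f x ≫ f.κ.hom.app ((c.L U).obj x) = V.U.map (c.ψ f x) :=
  (Category.assoc _ _ _).trans
    ((congrArg (fun t => _ ≫ t) (Iso.inv_hom_id_app f.κ _)).trans (Category.comp_id _))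

theorem ψ_co {U V : LMFunc.{v, u}} (f : U ⟶ V) (a : U.dom) :
    (c.L V).map (f.κ.hom.app a) ≫ c.co V (f.F.obj a) =
      c.ψ f (U.U.obj a) ≫ f.F.map (c.co U a) := by
  apply c.hom_ext
  have e1 : c.un V (f.G.obj (U.U.obj a)) ≫ V.U.map ((c.L V).map (f.κ.hom.app a)) =
    f.κ.hom.app a ≫ c.un V (V.U.obj (f.F.obj a)) := c.un_nat (f.κ.hom.app a)
  have h1 : c.un V (f.G.obj (U.U.obj a)) ≫ V.U.map ((c.L V).map (f.κ.hom.app a)) ≫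
      V.U.map (c.co V (f.F.obj a)) = f.κ.hom.app a := by
    rw [reassoc_of% e1, zigR]
    exact Category.comp_id _
  have h2 : f.G.map (c.un U (U.U.obj a)) ≫ f.G.map (U.U.map (c.co U a)) = 𝟙 _ := by
    rw [← Functor.map_comp, zigR, CategoryTheory.Functor.map_id]
  have h3 := c.un_ψ f (U.U.obj a)
  rw [Functor.map_comp, Functor.map_comp]
  refine h1.trans (Eq.trans ?_ ((reassoc_of% h3) (V.U.map (f.F.map (c.co U a)))).symm)
  rw [← κ_nat, reassoc_of% h2]

/-- The defining equation `κ ∘ Gα ∘ φU = βF ∘ Sκ` of `φ`, where `α = Uε` and `β = Vε` are the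
actions coming from the counits of the adjunctions. -/
theorem φApp_spec {U V : LMFunc.{v, u}} (f : U ⟶ V) (a : U.dom) :
    V.U.map ((c.L V).map (f.κ.hom.app a)) ≫ V.U.map (c.co V (f.F.obj a)) =
      c.φApp f (U.U.obj a) ≫ f.G.map (U.U.map (c.co U a)) ≫ f.κ.hom.app a := by
  rw [← Functor.map_comp, ψ_co, Functor.map_comp, ← φApp_κ, κ_nat, Category.assoc]

/-- `φ` is the only natural transformation satisfying its defining equation. -/
theorem φApp_unique {U V : LMFunc.{v, u}} (f : U ⟶ V)
    (χ : ∀ x : U.cod, V.U.obj ((c.L V).obj (f.G.obj x)) ⟶ f.G.obj (U.U.obj ((c.L U).obj x)))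
    (nat : ∀ {x y : U.cod} (t : x ⟶ y), V.U.map ((c.L V).map (f.G.map t)) ≫ χ y =
      χ x ≫ f.G.map (U.U.map ((c.L U).map t)))
    (h : ∀ a : U.dom, V.U.map ((c.L V).map (f.κ.hom.app a)) ≫ V.U.map (c.co V (f.F.obj a)) =
      χ (U.U.obj a) ≫ f.G.map (U.U.map (c.co U a)) ≫ f.κ.hom.app a) (x : U.cod) :
    χ x = c.φApp f x := by
  refine (cancel_mono (f.κ.hom.app ((c.L U).obj x))).1 (Eq.trans ?_ (c.φApp_κ f x).symm)
  have e2 : f.G.map (U.U.map ((c.L U).map (c.un U x))) ≫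
      f.G.map (U.U.map (c.co U ((c.L U).obj x))) = 𝟙 _ := by
    rw [← Functor.map_comp, ← Functor.map_comp, zigL]
    simp
  have e3 := h ((c.L U).obj x)
  rw [ψ, Functor.map_comp, Functor.map_comp, Functor.map_comp, Category.assoc]
  refine Eq.trans ?_ (congrArg (fun t => _ ≫ t) e3).symm
  rw [reassoc_of% nat (c.un U x), reassoc_of% e2]

/-- The 2-cell `φ : SG ⟶ GR` of `Q⟨F, κ, G⟩`, where `R = UŪ` and `S = VV̄`. -/
def φ {U V : LMFunc.{v, u}} (f : U ⟶ V) :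
    f.G ⋙ (c.adj V).toMonad.toFunctor ⟶ (c.adj U).toMonad.toFunctor ⋙ f.G where
  app := c.φApp f
  naturality _ _ t := c.φApp_nat f t

theorem κ_tensor {U V : LMFunc.{v, u}} (f : U ⟶ V) (a b : U.dom) :
    μ f.G (U.U.obj a) (U.U.obj b) ≫ f.G.map (μ U.U a b) ≫ f.κ.hom.app (a ⊗ b) =
      (f.κ.hom.app a ⊗ₘ f.κ.hom.app b) ≫ μ V.U _ _ ≫ V.U.map (μ f.F a b) :=
  (Category.assoc _ _ _).symm.trans (NatTrans.IsMonoidal.tensor (τ := f.κ.hom) a b)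

theorem κ_unit {U V : LMFunc.{v, u}} (f : U ⟶ V) :
    ε f.G ≫ f.G.map (ε U.U) ≫ f.κ.hom.app (𝟙_ U.dom) = ε V.U ≫ V.U.map (ε f.F) :=
  (Category.assoc _ _ _).symm.trans (NatTrans.IsMonoidal.unit (τ := f.κ.hom))

/-- The comonoidal structure of the left adjoint. -/
instance lOplax (U : LMFunc.{v, u}) : (c.L U).OplaxMonoidal := (c.adj U).leftAdjointOplaxMonoidal

theorem un_tensor (U : LMFunc.{v, u}) (x y : U.cod) :
    c.un U (x ⊗ y) ≫ U.U.map (δ (c.L U) x y) = (c.un U x ⊗ₘ c.un U y) ≫ μ U.U _ _ :=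
  (c.adj U).unit_app_tensor_comp_map_δ x y

theorem un_unit (U : LMFunc.{v, u}) :
    c.un U (𝟙_ U.cod) ≫ U.U.map (η (c.L U)) = ε U.U :=
  (c.adj U).unit_app_unit_comp_map_η

theorem ψ_tensor {U V : LMFunc.{v, u}} (f : U ⟶ V) (x y : U.cod) :
    (c.L V).map (μ f.G x y) ≫ c.ψ f (x ⊗ y) ≫ f.F.map (δ (c.L U) x y) =
      δ (c.L V) _ _ ≫ (c.ψ f x ⊗ₘ c.ψ f y) ≫ μ f.F _ _ := by
  apply c.hom_ext
  simp only [Functor.map_comp]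
  rw [reassoc_of% c.un_nat (μ f.G x y), reassoc_of% c.un_ψ f (x ⊗ y), ← κ_nat,
    ← Functor.map_comp_assoc, un_tensor, Functor.map_comp_assoc, ← μ_natural_assoc, κ_tensor,
    reassoc_of% c.un_tensor V (f.G.obj x) (f.G.obj y), ← μ_natural_assoc,
    tensorHom_comp_tensorHom_assoc, tensorHom_comp_tensorHom_assoc, un_ψ, un_ψ]

theorem ψ_unit {U V : LMFunc.{v, u}} (f : U ⟶ V) :
    (c.L V).map (ε f.G) ≫ c.ψ f (𝟙_ U.cod) ≫ f.F.map (η (c.L U)) = η (c.L V) ≫ ε f.F := by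
  apply c.hom_ext
  simp only [Functor.map_comp]
  rw [reassoc_of% c.un_nat (ε f.G), reassoc_of% c.un_ψ f (𝟙_ U.cod), ← κ_nat,
    ← Functor.map_comp_assoc, un_unit, κ_unit, reassoc_of% c.un_unit V]

theorem φ_tensor {U V : LMFunc.{v, u}} (f : U ⟶ V) (x y : U.cod) :
    V.U.map ((c.L V).map (μ f.G x y)) ≫ c.φApp f (x ⊗ y) ≫
        f.G.map (U.U.map (δ (c.L U) x y) ≫ δ U.U _ _) =
      (V.U.map (δ (c.L V) _ _) ≫ δ V.U _ _) ≫ (c.φApp f x ⊗ₘ c.φApp f y) ≫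
        μ f.G (U.U.obj ((c.L U).obj x)) (U.U.obj ((c.L U).obj y)) := by
  have : Mono (f.G.map (μ U.U ((c.L U).obj x) ((c.L U).obj y)) ≫ f.κ.hom.app _) :=
    mono_comp _ _
  rw [← cancel_mono (f.G.map (μ U.U ((c.L U).obj x) ((c.L U).obj y)) ≫ f.κ.hom.app _)]
  have h := congrArg V.U.map (c.ψ_tensor f x y)
  simp only [Functor.map_comp] at h
  have h1 : f.G.map (δ U.U ((c.L U).obj x) ((c.L U).obj y)) ≫
      f.G.map (μ U.U ((c.L U).obj x) ((c.L U).obj y)) = 𝟙 _ := by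
    rw [← Functor.map_comp, Functor.Monoidal.δ_μ, CategoryTheory.Functor.map_id]
  simp only [Functor.map_comp, Category.assoc]
  rw [reassoc_of% h1, κ_nat, reassoc_of% c.φApp_κ f (x ⊗ y), h, κ_tensor,
    tensorHom_comp_tensorHom_assoc, φApp_κ, φApp_κ, μ_natural_assoc,
    Functor.Monoidal.δ_μ_assoc]

theorem φ_unit {U V : LMFunc.{v, u}} (f : U ⟶ V) :
    V.U.map ((c.L V).map (ε f.G)) ≫ c.φApp f (𝟙_ U.cod) ≫
        f.G.map (U.U.map (η (c.L U)) ≫ η U.U) = (V.U.map (η (c.L V)) ≫ η V.U) ≫ ε f.G := by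
  have : Mono (f.G.map (ε U.U) ≫ f.κ.hom.app _) := mono_comp _ _
  rw [← cancel_mono (f.G.map (ε U.U) ≫ f.κ.hom.app _)]
  have h := congrArg V.U.map (c.ψ_unit f)
  simp only [Functor.map_comp] at h
  have h1 : f.G.map (η U.U) ≫ f.G.map (ε U.U) = 𝟙 _ := by
    rw [← Functor.map_comp, Functor.Monoidal.η_ε, CategoryTheory.Functor.map_id]
  simp only [Functor.map_comp, Category.assoc]
  rw [reassoc_of% h1, κ_nat, reassoc_of% c.φApp_κ f (𝟙_ U.cod), h, κ_unit,
    Functor.Monoidal.η_ε_assoc]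

theorem φ_mul {U V : LMFunc.{v, u}} (f : U ⟶ V) (x : U.cod) :
    V.U.map (c.co V ((c.L V).obj (f.G.obj x))) ≫ c.φApp f x =
      V.U.map ((c.L V).map (c.φApp f x)) ≫ c.φApp f (U.U.obj ((c.L U).obj x)) ≫
        f.G.map (U.U.map (c.co U ((c.L U).obj x))) := by
  refine (cancel_mono (f.κ.hom.app ((c.L U).obj x))).1 ?_
  have e := c.φApp_spec f ((c.L U).obj x)
  have e1 := congrArg (c.L V).map (c.φApp_κ f x)
  rw [Functor.map_comp] at e1
  simp only [Category.assoc]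
  refine Eq.trans ?_ (congrArg (fun t => _ ≫ t) e)
  rw [φApp_κ, ← Functor.map_comp, ← Functor.map_comp, ← Functor.map_comp, ← co_nat,
    reassoc_of% e1]

theorem φ_un {U V : LMFunc.{v, u}} (f : U ⟶ V) (x : U.cod) :
    c.un V (f.G.obj x) ≫ c.φApp f x = f.G.map (c.un U x) := by
  refine (cancel_mono (f.κ.hom.app ((c.L U).obj x))).1 ?_
  refine Eq.trans (Category.assoc _ _ _) ?_
  rw [φApp_κ, un_ψ]

/-- The 1-cell map of `Q`: `⟨F, κ, G⟩ ↦ ⟨G, φ⟩`. -/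
def qMap {U V : LMFunc.{v, u}} (f : U ⟶ V) : c.qObj U ⟶ c.qObj V where
  G := f.G
  laxG := f.laxG
  φ := c.φ f
  mul := c.φ_mul f
  unit := c.φ_un f
  ambi := by
    have h := @IsAmbimonoidal.mk U.cod V.cod U.cod V.cod _ _ _ _ _ _ _ _ f.G f.G
      (c.qObj U).T.toFunctor (c.qObj V).T.toFunctor f.laxG f.laxG
      (c.qObj U).bimonad.toOplaxMonoidal (c.qObj V).bimonad.toOplaxMonoidal (c.φ f)
    exact h (c.φ_tensor f) (c.φ_unit f)

theorem φ_ν {U V : LMFunc.{v, u}} {f g : U ⟶ V} (x : f ⟶ g) (y : U.cod) :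
    c.φApp f y ≫ (LMFunc.Hom₂.ν x).app (U.U.obj ((c.L U).obj y)) =
      V.U.map ((c.L V).map ((LMFunc.Hom₂.ν x).app y)) ≫ c.φApp g y := by
  refine (cancel_mono (g.κ.hom.app ((c.L U).obj y))).1 ?_
  have e := LMFunc.Hom₂.comm x ((c.L U).obj y)
  have e1 : (c.L V).map ((LMFunc.Hom₂.ν x).app y) ≫ c.ψ g y =
      c.ψ f y ≫ (LMFunc.Hom₂.θ x).app ((c.L U).obj y) := by
    apply c.hom_ext
    have e2 : f.G.map (c.un U y) ≫ (LMFunc.Hom₂.ν x).app (U.U.obj ((c.L U).obj y)) =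
      (LMFunc.Hom₂.ν x).app y ≫ g.G.map (c.un U y) := (LMFunc.Hom₂.ν x).naturality _
    rw [Functor.map_comp, Functor.map_comp, reassoc_of% c.un_nat, un_ψ,
      reassoc_of% c.un_ψ f y, e, reassoc_of% e2]
  rw [Category.assoc, Category.assoc, φApp_κ]
  refine Eq.trans (congrArg (fun t => _ ≫ t) e.symm) ?_
  rw [reassoc_of% c.φApp_κ f y, ← Functor.map_comp, ← Functor.map_comp, e1]

/-- The 2-cell map of `Q`: `[θ, ν] ↦ ν`. -/
def qMap₂ {U V : LMFunc.{v, u}} {f g : U ⟶ V} (x : f ⟶ g) : c.qMap f ⟶ c.qMap g where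
  ν := LMFunc.Hom₂.ν x
  monν := x.monν
  comm := c.φ_ν x

theorem ψ_id (U : LMFunc.{v, u}) (x : U.cod) : c.ψ (𝟙 U) x = 𝟙 ((c.L U).obj x) := by
  apply c.hom_ext
  refine (c.un_ψ (𝟙 U) x).trans ?_
  change c.un U x ≫ 𝟙 _ = c.un U x ≫ U.U.map (𝟙 _)
  simp

theorem ψ_comp {U V W : LMFunc.{v, u}} (f : U ⟶ V) (g : V ⟶ W) (x : U.cod) :
    c.ψ (f ≫ g) x = c.ψ g (f.G.obj x) ≫ g.F.map (c.ψ f x) := by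
  apply c.hom_ext
  refine (c.un_ψ (f ≫ g) x).trans ?_
  change g.G.map (f.G.map (c.un U x)) ≫ g.G.map (f.κ.hom.app _) ≫ g.κ.hom.app _ =
    c.un W (g.G.obj (f.G.obj x)) ≫ W.U.map (c.ψ g (f.G.obj x) ≫ g.F.map (c.ψ f x))
  rw [Functor.map_comp, reassoc_of% c.un_ψ g (f.G.obj x), ← κ_nat, ← Functor.map_comp_assoc,
    ← Functor.map_comp_assoc, un_ψ]

theorem φ_id (U : LMFunc.{v, u}) (x : U.cod) :
    c.φApp (𝟙 U) x = 𝟙 (U.U.obj ((c.L U).obj x)) := by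
  have h : U.U.map (c.ψ (𝟙 U) x) = 𝟙 (U.U.obj ((c.L U).obj x)) :=
    (congrArg U.U.map (c.ψ_id U x)).trans (U.U.map_id _)
  exact (Category.comp_id _).trans h

theorem φ_comp {U V W : LMFunc.{v, u}} (f : U ⟶ V) (g : V ⟶ W) (x : U.cod) :
    c.φApp (f ≫ g) x = c.φApp g (f.G.obj x) ≫ g.G.map (c.φApp f x) := by
  refine (cancel_mono ((f ≫ g).κ.hom.app ((c.L U).obj x))).1
    ((c.φApp_κ (f ≫ g) x).trans ?_)
  change W.U.map (c.ψ (f ≫ g) x) =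
    (c.φApp g (f.G.obj x) ≫ g.G.map (c.φApp f x)) ≫ g.G.map (f.κ.hom.app _) ≫ g.κ.hom.app _
  rw [Category.assoc, ← Functor.map_comp_assoc, φApp_κ, κ_nat, reassoc_of% c.φApp_κ g (f.G.obj x),
    ψ_comp]
  exact W.U.map_comp _ _

theorem qMap_id (U : LMFunc.{v, u}) : c.qMap (𝟙 U) = 𝟙 (c.qObj U) :=
  Bmd.Hom₁.mk_congr rfl (NatTrans.ext (funext fun x => c.φ_id U x))

theorem qMap_comp {U V W : LMFunc.{v, u}} (f : U ⟶ V) (g : V ⟶ W) :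
    c.qMap (f ≫ g) = c.qMap f ≫ c.qMap g :=
  Bmd.Hom₁.mk_congr rfl (NatTrans.ext (funext fun x => c.φ_comp f g x))

/-- The 2-functor `Q : L-MFunc ⟶ Bmd` determined by a choice of adjunctions. -/
def Q : StrictPseudofunctor LMFunc.{v, u} Bmd.{v, u} :=
  StrictPseudofunctor.mk''
    { obj := c.qObj
      map := c.qMap
      map₂ := c.qMap₂
      map₂_id := fun f => Bmd.hom₂_ext (fun _ => rfl)
      map₂_comp := fun x y => Bmd.hom₂_ext (fun _ => rfl)
      map_id := c.qMap_id
      map_comp := c.qMap_comp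
      map₂_whisker_left := fun {a b d} f {g h} x => Bmd.hom₂_ext (fun y => by
        rw [Bmd.comp_ν, Bmd.comp_ν, Bmd.eqToHom_ν, Bmd.eqToHom_ν]
        exact ((Category.id_comp _).trans (Category.comp_id _)).symm)
      map₂_whisker_right := fun {a b d f g} x h => Bmd.hom₂_ext (fun y => by
        rw [Bmd.comp_ν, Bmd.comp_ν, Bmd.eqToHom_ν, Bmd.eqToHom_ν]
        exact ((Category.id_comp _).trans (Category.comp_id _)).symm) }

end AdjunctionChoice

end BimonadEM

/-!
The unit of the adjunction at a monoidal functor `U : A ⥤ M` with left adjoint `Ū` is the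
Eilenberg–Moore comparison functor `a ↦ ⟨Ua, Uε_a⟩` into the algebras of the bimonad `UŪ`, lying
over the identity of `M`; its lax monoidal structure is that of `U` (`unitApp`). For a 1-cell
`⟨F, κ, G⟩` the defining equation of `φ` (`φApp_spec`) says that `κ⁻¹` is a morphism of algebras from
the comparison of `Fa` to `G^φ` of the comparison of `a`, so `[κ⁻¹, 1]` is an invertible naturality
2-cell (`unitNaturality`). It is the only constraint 2-cell in the construction whose underlying
morphisms are not identities.

The counit at a bimonad `T` compares `T` with the bimonad `UŪ` of the chosen left adjoint `Ū` of the
forgetful functor of its algebras. The two monads come from two left adjoints of the same functor,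
and the comparison `Tx ⟶ UŪx` is the free extension of the unit `x ⟶ UŪx` to an algebra morphism
(`compar`). Everything about it follows from `compar_comp`, which evaluates a composite of the
comparison with an algebra morphism `s : Ūx ⟶ a` in terms of the restriction of `s` to generators:
compatibility with multiplication and unit, comonoidality (as `δ` and `η` of `Ū` are algebra
morphisms), and strict naturality in the 1-cells of `Bmd` (`compar_φApp`, as the mate of `κ` is an
algebra morphism).

The triangle identities on 1-cells are `compar_comp` once more: at `U` the comparison followed by
`Q` of the comparison functor is `UŪη` followed by `UεŪ`, which is the identity, and at `T` restricting
`Uε_a` along the comparison gives back the action of the algebra `a` (`compar_freeCounit`). Their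
2-cells have identity components, because at the objects involved `κ` is an identity and every
constraint of the two 2-functors is an `eqToHom` between 1-cells whose underlying functors agree
definitionally.
-/

namespace BimonadEM

open MonoidalCategory Functor.LaxMonoidal Functor.OplaxMonoidal

/-! ### Equality of pseudo natural transformations -/

/-- Pseudo natural transformations are equal if their component 1-cells are equal and their
naturality 2-cells correspond under the resulting identifications. -/
theorem strongTrans_ext {A B : Type*} [Bicategory A] [Bicategory B] {F G : Pseudofunctor A B}
    {η θ : Pseudofunctor.StrongTrans F G} (h : ∀ a, η.app a = θ.app a)
    (h' : ∀ {a b : A} (f : a ⟶ b), (η.naturality f).hom ≫ eqToHom (by rw [h]) =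
      eqToHom (by rw [h]) ≫ (θ.naturality f).hom) : η = θ := by
  obtain ⟨p, n, _, _, _⟩ := η
  obtain ⟨q, m, _, _, _⟩ := θ
  obtain rfl : p = q := funext h
  have : @n = @m := by
    funext a b f
    have := h' f
    simp only [eqToHom_refl, Category.comp_id, Category.id_comp] at this
    exact Iso.ext this
  subst this
  rfl

/-! ### Components of the constraints of `EM` and `Q` -/

/-- Collapses composites of morphisms that are identities up to unfolding. The constraint 2-cells of
the counit, of `Q` and of `EM` have identity components, but between objects that agree only after
unfolding composites of 1-cells, which is out of reach of `rw` and `simp`; applied as a term, the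
lemma lets unification do the unfolding. -/
theorem comp_eq_id {C : Type*} [Category* C] {x : C} {s t : x ⟶ x} (hs : s = 𝟙 x) (ht : t = 𝟙 x) :
    s ≫ t = 𝟙 x := by
  rw [hs, ht, Category.comp_id]

/-- When the two objects agree by definition, the right-hand side unfolds to an identity; this is
how the constraints of `Q` and, likewise, of `EM` are seen to have identity components. -/
theorem Bmd.eqToHom_ν_app {X Y : Bmd.{v, u}} {f g : X ⟶ Y} (h : f = g) (x : X.carrier) :
    (Hom₂.ν (eqToHom h)).app x = eqToHom (by rw [h]) := by
  subst h
  rfl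

theorem LMFunc.eqToHom_ν_app {U V : LMFunc.{v, u}} {f g : U ⟶ V} (h : f = g) (x : U.cod) :
    (Hom₂.ν (eqToHom h)).app x = eqToHom (by rw [h]) := by
  subst h
  rfl

section Constraints

variable {X Y Z : Bmd.{v, u}} (f : X ⟶ Y) (g : Y ⟶ Z)

theorem EM_mapId_ν (x : X.carrier) :
    (LMFunc.Hom₂.ν (EM.{v, u}.toPseudofunctor.mapId X).hom).app x = 𝟙 x :=
  LMFunc.eqToHom_ν_app (Bmd.emMap_id X) x

theorem EM_mapId_θ (a : X.T.Algebra) :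
    ((LMFunc.Hom₂.θ (EM.{v, u}.toPseudofunctor.mapId X).hom).app a).f = 𝟙 a.A :=
  Bmd.em_eqToHom_θ_f (Bmd.emMap_id X) a

theorem EM_mapComp_ν (x : X.carrier) :
    (LMFunc.Hom₂.ν (EM.{v, u}.toPseudofunctor.mapComp f g).hom).app x = 𝟙 (g.G.obj (f.G.obj x)) :=
  LMFunc.eqToHom_ν_app (Bmd.emMap_comp f g) x

theorem EM_mapComp_θ (a : X.T.Algebra) :
    ((LMFunc.Hom₂.θ (EM.{v, u}.toPseudofunctor.mapComp f g).hom).app a).f =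
      𝟙 (g.G.obj (f.G.obj a.A)) :=
  Bmd.em_eqToHom_θ_f (Bmd.emMap_comp f g) a

theorem EM_mapComp_inv_ν (x : X.carrier) :
    (LMFunc.Hom₂.ν (EM.{v, u}.toPseudofunctor.mapComp f g).inv).app x = 𝟙 (g.G.obj (f.G.obj x)) :=
  LMFunc.eqToHom_ν_app (Bmd.emMap_comp f g).symm x

theorem EM_mapComp_inv_θ (a : X.T.Algebra) :
    ((LMFunc.Hom₂.θ (EM.{v, u}.toPseudofunctor.mapComp f g).inv).app a).f =
      𝟙 (g.G.obj (f.G.obj a.A)) :=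
  Bmd.em_eqToHom_θ_f (Bmd.emMap_comp f g).symm a

end Constraints

namespace AdjunctionChoice

variable (c : AdjunctionChoice.{v, u})

section Constraints

variable {U V W : LMFunc.{v, u}} (f : U ⟶ V) (g : V ⟶ W)

theorem Q_mapId_ν (x : U.cod) :
    (Bmd.Hom₂.ν (c.Q.toPseudofunctor.mapId U).hom).app x = 𝟙 x :=
  Bmd.eqToHom_ν_app (c.qMap_id U) x

theorem Q_mapComp_ν (x : U.cod) :
    (Bmd.Hom₂.ν (c.Q.toPseudofunctor.mapComp f g).hom).app x = 𝟙 (g.G.obj (f.G.obj x)) :=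
  Bmd.eqToHom_ν_app (c.qMap_comp f g) x

theorem Q_mapComp_inv_ν (x : U.cod) :
    (Bmd.Hom₂.ν (c.Q.toPseudofunctor.mapComp f g).inv).app x = 𝟙 (g.G.obj (f.G.obj x)) :=
  Bmd.eqToHom_ν_app (c.qMap_comp f g).symm x

end Constraints

/-! ### The comparison of a bimonad with the bimonad of its algebras -/

section Counit

variable (X : Bmd.{v, u})

/-- The free algebra on `x`, as given by the chosen left adjoint of the forgetful functor. This and
the next three definitions give the data of the chosen adjunction types in which the domain of
`Bmd.emObj X` is visibly a category of algebras. -/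
def freeAlg (x : X.carrier) : X.T.Algebra := (c.L (Bmd.emObj X)).obj x

/-- The inclusion of generators `x ⟶ UŪx`, for the chosen free algebra `Ūx`. -/
def freeUnit (x : X.carrier) : x ⟶ (c.freeAlg X x).A := c.un (Bmd.emObj X) x

/-- The action of the left adjoint on morphisms. -/
def freeMap {x y : X.carrier} (t : x ⟶ y) : c.freeAlg X x ⟶ c.freeAlg X y :=
  (c.L (Bmd.emObj X)).map t

/-- The algebra morphism `Ūx ⟶ a` extending the identity of the carrier of `a`. -/
def freeCounit (a : X.T.Algebra) : c.freeAlg X a.A ⟶ a := c.co (Bmd.emObj X) a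

theorem freeUnit_nat {x y : X.carrier} (t : x ⟶ y) :
    c.freeUnit X x ≫ (c.freeMap X t).f = t ≫ c.freeUnit X y :=
  c.un_nat (U := Bmd.emObj X) t

theorem freeUnit_freeCounit (a : X.T.Algebra) :
    c.freeUnit X a.A ≫ (c.freeCounit X a).f = 𝟙 a.A :=
  c.zigR (Bmd.emObj X) a

/-- The components of the comparison `T ⟶ UŪ` between a monad and the monad induced by the chosen
adjunction of its Eilenberg–Moore category: `Tx ⟶ UŪx` is the algebra morphism out of the
canonical free algebra that extends the unit of the chosen adjunction. -/
def compar (x : X.carrier) : X.T.obj x ⟶ (c.freeAlg X x).A :=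
  X.T.map (c.freeUnit X x) ≫ (c.freeAlg X x).a

/-- The comparison followed by an algebra morphism `s` out of the chosen free algebra is the
morphism out of the canonical free algebra with the same restriction to generators. -/
theorem compar_comp (x : X.carrier) {a : X.T.Algebra} (s : c.freeAlg X x ⟶ a) :
    c.compar X x ≫ s.f = X.T.map (c.freeUnit X x ≫ s.f) ≫ a.a := by
  rw [compar, Category.assoc, ← s.h, Functor.map_comp, Category.assoc]

theorem compar_nat {x y : X.carrier} (t : x ⟶ y) :
    X.T.map t ≫ c.compar X y = c.compar X x ≫ (c.freeMap X t).f := by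
  rw [compar_comp, freeUnit_nat, Functor.map_comp, Category.assoc]
  rfl

/-- Restricted along the comparison, the action `Uε_a` of the induced monad is the action of `a`. -/
theorem compar_freeCounit (a : X.T.Algebra) :
    c.compar X a.A ≫ (c.freeCounit X a).f = a.a := by
  rw [compar_comp, freeUnit_freeCounit, CategoryTheory.Functor.map_id, Category.id_comp]

/-- The comparison preserves units of monads. -/
theorem unit_compar (x : X.carrier) : X.T.η.app x ≫ c.compar X x = c.freeUnit X x := by
  have e : X.T.η.app x ≫ X.T.map (c.freeUnit X x) =
    c.freeUnit X x ≫ X.T.η.app _ := (X.T.η.naturality _).symm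
  rw [compar, reassoc_of% e, Monad.Algebra.unit, Category.comp_id]

/-- The comparison preserves multiplications of monads; the last factor is the multiplication of
`UŪ`. -/
theorem mul_compar (x : X.carrier) :
    X.T.μ.app x ≫ c.compar X x =
      X.T.map (c.compar X x) ≫ c.compar X (c.freeAlg X x).A ≫
        (c.freeCounit X (c.freeAlg X x)).f := by
  have e : X.T.μ.app x ≫ X.T.map (c.freeUnit X x) =
    X.T.map (X.T.map (c.freeUnit X x)) ≫ X.T.μ.app _ := (X.T.μ.naturality _).symm
  rw [compar_freeCounit, compar, reassoc_of% e, Monad.Algebra.assoc, Functor.map_comp,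
    Category.assoc]

/-- The comonoidal structure of the left adjoint, as an algebra morphism. -/
def freeδ (x y : X.carrier) : c.freeAlg X (x ⊗ y) ⟶ algTensor X.T (c.freeAlg X x) (c.freeAlg X y) :=
  δ (c.L (Bmd.emObj X)) x y

/-- The counit of the comonoidal structure of the left adjoint, as an algebra morphism. -/
def freeη : c.freeAlg X (𝟙_ X.carrier) ⟶ algUnit X.T :=
  η (c.L (Bmd.emObj X))

/-- The comparison is comonoidal. As `δ` of `Ū` is an algebra morphism, it suffices to compare on
generators, where `δ` of `Ū` restricts to the tensor product of the units. -/
theorem compar_tensor (x y : X.carrier) :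
    c.compar X (x ⊗ y) ≫ (c.freeδ X x y).f =
      δ X.T.toFunctor x y ≫ (c.compar X x ⊗ₘ c.compar X y) := by
  have h : c.freeUnit X (x ⊗ y) ≫ (c.freeδ X x y).f = c.freeUnit X x ⊗ₘ c.freeUnit X y :=
    (c.un_tensor (Bmd.emObj X) x y).trans (Category.comp_id _)
  rw [compar_comp, h]
  change X.T.map (_ ⊗ₘ _) ≫ δ X.T.toFunctor _ _ ≫ (_ ⊗ₘ _) = _
  rw [← δ_natural_assoc, tensorHom_comp_tensorHom]
  rfl

theorem compar_unit :
    c.compar X (𝟙_ X.carrier) ≫ (c.freeη X).f = η X.T.toFunctor := by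
  have h : c.freeUnit X (𝟙_ X.carrier) ≫ (c.freeη X).f = 𝟙 _ :=
    c.un_unit (Bmd.emObj X)
  rw [compar_comp, h]
  change X.T.map (𝟙 _) ≫ η X.T.toFunctor = _
  rw [CategoryTheory.Functor.map_id, Category.id_comp]

/-- The comparison `T ⟶ UŪ` as a natural transformation. -/
def comparTrans :
    (𝟭 X.carrier : X.carrier ⥤ X.carrier) ⋙ X.T.toFunctor ⟶
      (c.qObj (Bmd.emObj X)).T.toFunctor ⋙ (𝟭 X.carrier : X.carrier ⥤ X.carrier) where
  app := c.compar X
  naturality _ _ t := c.compar_nat X t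

/-- The component of the counit at a bimonad `T`: the identity functor together with the comparison
`T ⟶ UŪ`. -/
def counitApp : c.qObj (Bmd.emObj X) ⟶ X where
  G := (𝟭 X.carrier : X.carrier ⥤ X.carrier)
  laxG := (inferInstance : (𝟭 X.carrier : X.carrier ⥤ X.carrier).LaxMonoidal)
  φ := c.comparTrans X
  mul := c.mul_compar X
  unit := c.unit_compar X
  ambi := by
    -- The carrier of the source is `X.carrier` only after unfolding, which instance search does not
    -- do, so the structures are supplied by hand.
    have h := @IsAmbimonoidal.mk X.carrier X.carrier X.carrier X.carrier _ _ _ _ _ _ _ _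
      (𝟭 X.carrier) (𝟭 X.carrier) (c.qObj (Bmd.emObj X)).T.toFunctor X.T.toFunctor
      inferInstance inferInstance
      (c.qObj (Bmd.emObj X)).bimonad.toOplaxMonoidal X.bimonad.toOplaxMonoidal (c.comparTrans X)
    refine h (fun x y => ?_) ?_
    · refine Eq.trans ?_ ((c.compar_tensor X x y).trans ?_)
      · change X.T.map (𝟙 (x ⊗ y : X.carrier)) ≫ c.compar X (x ⊗ y) ≫ (c.freeδ X x y).f ≫ 𝟙 _ = _
        rw [CategoryTheory.Functor.map_id, Category.id_comp]
        exact congrArg (fun t => _ ≫ t) (Category.comp_id _)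
      · exact congrArg (fun t => _ ≫ t) (Category.comp_id _).symm
    · refine Eq.trans ?_ ((c.compar_unit X).trans (Category.comp_id _).symm)
      change X.T.map (𝟙 (𝟙_ X.carrier)) ≫ c.compar X (𝟙_ _) ≫ (c.freeη X).f ≫ 𝟙 _ = _
      rw [CategoryTheory.Functor.map_id, Category.id_comp]
      exact congrArg (fun t => _ ≫ t) (Category.comp_id _)

end Counit

/-- Strict naturality of the comparison in the 1-cells of `Bmd`. The 2-cell of `Q` at `EM f` is
underlain by the mate of `κ`, an algebra morphism out of a chosen free algebra whose restriction to
generators is `G` of the unit. -/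
theorem compar_φApp {X Y : Bmd.{v, u}} (f : X ⟶ Y) (x : X.carrier) :
    c.compar Y (f.G.obj x) ≫ c.φApp (Bmd.emMap f) x = f.φ.app x ≫ f.G.map (c.compar X x) := by
  let s : c.freeAlg Y (f.G.obj x) ⟶ (Bmd.algFunctor f).obj (c.freeAlg X x) := c.ψ (Bmd.emMap f) x
  have h : c.freeUnit Y (f.G.obj x) ≫ s.f = f.G.map (c.freeUnit X x) :=
    (c.un_ψ (Bmd.emMap f) x).trans (Category.comp_id _)
  have hφ : c.φApp (Bmd.emMap f) x = s.f := Category.comp_id _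
  have e : Y.T.map (f.G.map (c.freeUnit X x)) ≫ f.φ.app _ =
    f.φ.app x ≫ f.G.map (X.T.map (c.freeUnit X x)) := f.φ.naturality _
  refine (congrArg (fun t => c.compar Y (f.G.obj x) ≫ t) hφ).trans ?_
  refine (c.compar_comp Y _ s).trans ?_
  rw [h]
  change Y.T.map (f.G.map (c.freeUnit X x)) ≫ f.φ.app _ ≫ f.G.map (c.freeAlg X x).a = _
  rw [reassoc_of% e, ← Functor.map_comp]
  rfl

/-! ### The counit -/

/-- The naturality squares of the counit commute strictly. The underlying functors of both composites
are `G`, and their lax structures differ only by identities. -/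
theorem counit_naturality {X Y : Bmd.{v, u}} (f : X ⟶ Y) :
    c.qMap (Bmd.emMap f) ≫ c.counitApp Y = c.counitApp X ≫ f :=
  Bmd.Hom₁.mk_congr (l := (c.qMap (Bmd.emMap f) ≫ c.counitApp Y).laxG)
    (l' := (c.counitApp X ≫ f).laxG)
    (Functor.LaxMonoidal.ext (by
      change 𝟙 _ ≫ ε f.G = ε f.G ≫ f.G.map (𝟙 _)
      simp) (by
      funext x y
      change 𝟙 _ ≫ μ f.G x y = μ f.G x y ≫ f.G.map (𝟙 _)
      simp))
    (NatTrans.ext (funext fun x => c.compar_φApp f x))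

theorem counit_naturality_ν {X Y : Bmd.{v, u}} (f : X ⟶ Y) (x : X.carrier) :
    (Bmd.Hom₂.ν (eqToIso (c.counit_naturality f)).hom).app x = 𝟙 (f.G.obj x) :=
  Bmd.eqToHom_ν_app (c.counit_naturality f) x

/-- The counit `ζ : Q ∗ EM ⟶ 1`. -/
def counit : Pseudofunctor.StrongTrans (EM.{v, u}.toPseudofunctor.comp c.Q.toPseudofunctor)
    (Pseudofunctor.id Bmd.{v, u}) where
  app := c.counitApp
  naturality f := eqToIso (c.counit_naturality f)
  naturality_naturality {_ _ f g} _ := Bmd.hom₂_ext (fun x =>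
    ((congrArg (fun s => _ ≫ s) (c.counit_naturality_ν g x)).trans (Category.comp_id _)).trans
      ((congrArg (fun s => s ≫ _) (c.counit_naturality_ν f x)).trans (Category.id_comp _)).symm)
  naturality_id X := Bmd.hom₂_ext (fun x => (comp_eq_id (c.counit_naturality_ν (𝟙 X) x) rfl).trans
    (comp_eq_id (comp_eq_id (EM_mapId_ν (X := X) x) (c.Q_mapId_ν (U := Bmd.emObj X) x))
      (comp_eq_id rfl rfl)).symm)
  naturality_comp f g := Bmd.hom₂_ext (fun x =>
    (comp_eq_id (c.counit_naturality_ν (f ≫ g) x) rfl).trans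
      (comp_eq_id
        (comp_eq_id (EM_mapComp_ν f g x) (c.Q_mapComp_ν (Bmd.emMap f) (Bmd.emMap g) x))
        (comp_eq_id rfl (comp_eq_id (c.counit_naturality_ν g (f.G.obj x)) (comp_eq_id rfl
          (comp_eq_id ((congrArg g.G.map (c.counit_naturality_ν f x)).trans (g.G.map_id _))
            rfl))))).symm)

theorem counit_is2Natural : Is2Natural c.counit :=
  fun _ _ f => ⟨c.counit_naturality f, rfl⟩

/-! ### The unit -/

section Comparison

variable (U : LMFunc.{v, u})

/-- The bimonad structure of `qObj`, restated for instance search, which sees the monad of `qObj U`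
as the monad of the adjunction. -/
instance qObjBimonad : Bimonad (c.adj U).toMonad := adjBimonad (c.adj U)

/-- The comonoidal counit of `Ū` is the mate of the unit of the monoidal structure of `U`. -/
theorem map_ε_co : (c.L U).map (ε U.U) ≫ c.co U (𝟙_ U.dom) = η (c.L U) :=
  (c.adj U).map_ε_comp_counit_app_unit

/-- The comonoidal structure of `Ū` is the mate of the monoidal structure of `U`. -/
theorem map_μ_co (a b : U.dom) :
    (c.L U).map (μ U.U a b) ≫ c.co U (a ⊗ b) =
      δ (c.L U) _ _ ≫ (c.co U a ⊗ₘ c.co U b) :=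
  (c.adj U).map_μ_comp_counit_app_tensor a b

/-- The action of the induced monad on the functor `U`, given by the counit of the adjunction. -/
def counitAct : U.U ⋙ (c.qObj U).T.toFunctor ⟶ U.U where
  app a := U.U.map (c.co U a)
  naturality a b t := by
    change U.U.map ((c.L U).map (U.U.map t)) ≫ U.U.map (c.co U b) = U.U.map (c.co U a) ≫ U.U.map t
    rw [← Functor.map_comp, co_nat, Functor.map_comp]

theorem counitAct_assoc (a : U.dom) :
    U.U.map (c.co U ((c.L U).obj (U.U.obj a))) ≫ U.U.map (c.co U a) =
      U.U.map ((c.L U).map (U.U.map (c.co U a))) ≫ U.U.map (c.co U a) := by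
  rw [← Functor.map_comp, ← Functor.map_comp, co_nat]

/-- The Eilenberg–Moore comparison functor `a ↦ ⟨Ua, Uε_a⟩`. -/
def comparison : U.dom ⥤ (c.qObj U).T.Algebra :=
  Bmd.liftAlg (T := (c.qObj U).T) U.U (c.counitAct U) (c.zigR U) (c.counitAct_assoc U)

/-- The lax monoidal structure of the comparison functor is that of `U`. -/
instance comparisonLax : (c.comparison U).LaxMonoidal where
  ε :=
    { f := ε U.U
      h := by
        change U.U.map ((c.L U).map (ε U.U)) ≫ U.U.map (c.co U _) =
          (U.U.map (η (c.L U)) ≫ η U.U) ≫ ε U.U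
        rw [← Functor.map_comp, map_ε_co, Category.assoc, Functor.Monoidal.η_ε, Category.comp_id] }
  μ a b :=
    { f := μ U.U a b
      h := by
        change U.U.map ((c.L U).map (μ U.U a b)) ≫ U.U.map (c.co U (a ⊗ b)) =
          ((U.U.map (δ (c.L U) (U.U.obj a) (U.U.obj b)) ≫ δ U.U _ _) ≫
            (U.U.map (c.co U a) ⊗ₘ U.U.map (c.co U b))) ≫ μ U.U a b
        rw [← Functor.map_comp, map_μ_co, Functor.map_comp, Category.assoc, Category.assoc,
          μ_natural, Functor.Monoidal.δ_μ_assoc] }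
  μ_natural_left s b := Monad.Algebra.Hom.ext (μ_natural_left U.U s b)
  μ_natural_right a s := Monad.Algebra.Hom.ext (μ_natural_right U.U a s)
  associativity a b d := Monad.Algebra.Hom.ext (associativity U.U a b d)
  left_unitality a := Monad.Algebra.Hom.ext (left_unitality U.U a)
  right_unitality a := Monad.Algebra.Hom.ext (right_unitality U.U a)

/-- The identity natural isomorphism between `U` and the carrier of the comparison functor. -/
def comparisonκ : U.U ⋙ (𝟭 U.cod : U.cod ⥤ U.cod) ≅ c.comparison U ⋙ (c.qObj U).T.forget :=
  NatIso.ofComponents (fun a => Iso.refl (U.U.obj a)) (fun {a b} t => by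
    change U.U.map t ≫ 𝟙 _ = 𝟙 _ ≫ U.U.map t
    simp)

instance comparisonκ_isMonoidal : NatTrans.IsMonoidal (c.comparisonκ U).hom where
  unit := by
    change (𝟙 _ ≫ ε U.U) ≫ 𝟙 _ = 𝟙 _ ≫ ε U.U
    simp
  tensor a b := by
    change (𝟙 _ ≫ μ U.U a b) ≫ 𝟙 _ = (𝟙 _ ⊗ₘ 𝟙 _) ≫ 𝟙 _ ≫ μ U.U a b
    simp

/-- The component of the unit at `U`: the comparison functor into the Eilenberg–Moore category of
the induced bimonad, over the identity of the base. -/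
def unitApp : U ⟶ Bmd.emObj (c.qObj U) where
  F := c.comparison U
  G := (𝟭 U.cod : U.cod ⥤ U.cod)
  laxF := c.comparisonLax U
  laxG := (inferInstance : (𝟭 U.cod : U.cod ⥤ U.cod).LaxMonoidal)
  κ := c.comparisonκ U
  monκ := c.comparisonκ_isMonoidal U

end Comparison

section UnitNaturality

variable {U V : LMFunc.{v, u}} (f : U ⟶ V)

/-- The inverse of `κ` is a morphism of algebras `⟨VFa, Vε⟩ ⟶ ⟨GUa, GUε ∘ φ⟩`. -/
def unitSquare (a : U.dom) :
    (c.comparison V).obj (f.F.obj a) ≅ (Bmd.algFunctor (c.qMap f)).obj ((c.comparison U).obj a) :=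
  Monad.Algebra.isoMk (f.κ.app a).symm (by
    change V.U.map ((c.L V).map (f.κ.inv.app a)) ≫ c.φApp f (U.U.obj a) ≫
      f.G.map (U.U.map (c.co U a)) = V.U.map (c.co V (f.F.obj a)) ≫ f.κ.inv.app a
    have e := c.φApp_spec f a
    have e1 : (c.L V).map (f.κ.inv.app a) ≫ (c.L V).map (f.κ.hom.app a) = 𝟙 _ := by
      rw [← Functor.map_comp, Iso.inv_hom_id_app, CategoryTheory.Functor.map_id]
    refine (cancel_mono (f.κ.hom.app a)).1 ?_
    rw [Category.assoc, Category.assoc, Category.assoc, ← e, Iso.inv_hom_id_app,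
      ← Functor.map_comp_assoc, e1, CategoryTheory.Functor.map_id, Category.id_comp]
    exact (Category.comp_id _).symm)

/-- The natural isomorphism `K_V F ≅ G^φ K_U` lying over `κ⁻¹ : VF ≅ GU`. -/
def unitθ : f.F ⋙ c.comparison V ≅ c.comparison U ⋙ Bmd.algFunctor (c.qMap f) :=
  NatIso.ofComponents (c.unitSquare f)
    (fun t => Monad.Algebra.Hom.ext (κi_nat f t))

/-- The naturality 2-cell `[κ⁻¹, 1]` of the unit at `⟨F, κ, G⟩`. -/
def unitNaturality : f ≫ c.unitApp V ≅ c.unitApp U ≫ Bmd.emMap (c.qMap f) :=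
  LMFunc.isoMk (c.unitθ f) (Iso.refl f.G)
    { unit := Monad.Algebra.Hom.ext (by
        have e := κ_unit f
        change (ε V.U ≫ V.U.map (ε f.F)) ≫ f.κ.inv.app (𝟙_ _) = ε f.G ≫ f.G.map (ε U.U)
        rw [← e]
        simp)
      tensor := fun a b => Monad.Algebra.Hom.ext (by
        have e := κ_tensor f a b
        change (μ V.U _ _ ≫ V.U.map (μ f.F a b)) ≫ f.κ.inv.app (a ⊗ b) =
          (f.κ.inv.app a ⊗ₘ f.κ.inv.app b) ≫ μ f.G _ _ ≫ f.G.map (μ U.U a b)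
        refine (cancel_mono (f.κ.hom.app (a ⊗ b))).1 ?_
        refine (cancel_epi (f.κ.hom.app a ⊗ₘ f.κ.hom.app b)).1 ?_
        simp [e]) }
    { unit := by
        change (𝟙 _ ≫ ε f.G) ≫ 𝟙 _ = ε f.G ≫ f.G.map (𝟙 _)
        simp
      tensor := fun x y => by
        change (𝟙 _ ≫ μ f.G x y) ≫ 𝟙 _ = (𝟙 _ ⊗ₘ 𝟙 _) ≫ μ f.G x y ≫ f.G.map (𝟙 _)
        simp }
    (fun a => by
      change (f.κ.hom.app a ≫ 𝟙 _) ≫ f.κ.inv.app a = 𝟙 _ ≫ f.G.map (𝟙 _) ≫ 𝟙 _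
      simp)

end UnitNaturality

theorem κi_comm {U V : LMFunc.{v, u}} {f g : U ⟶ V} (t : f ⟶ g) (a : U.dom) :
    V.U.map ((LMFunc.Hom₂.θ t).app a) ≫ g.κ.inv.app a =
      f.κ.inv.app a ≫ (LMFunc.Hom₂.ν t).app (U.U.obj a) := by
  have e := LMFunc.Hom₂.comm t a
  refine (cancel_mono (g.κ.hom.app a)).1 ?_
  refine (cancel_epi (f.κ.hom.app a)).1 ?_
  simp [e]

/-- The unit `ξ : 1 ⟶ EM ∗ Q`. -/
def unit : Pseudofunctor.StrongTrans (Pseudofunctor.id LMFunc.{v, u})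
    (c.Q.toPseudofunctor.comp EM.{v, u}.toPseudofunctor) where
  app := c.unitApp
  naturality := c.unitNaturality
  naturality_naturality {U V f g} t := LMFunc.hom₂_ext
    (fun a => Monad.Algebra.Hom.ext (by
      change V.U.map ((LMFunc.Hom₂.θ t).app a) ≫ g.κ.inv.app a =
        f.κ.inv.app a ≫ (LMFunc.Hom₂.ν t).app (U.U.obj a)
      exact κi_comm t a))
    (fun x => (Category.comp_id _).trans (Category.id_comp _).symm)
  naturality_id U := LMFunc.hom₂_ext
    (fun a => Monad.Algebra.Hom.ext
      ((comp_eq_id (C := U.cod) (x := U.U.obj a) rfl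
        (comp_eq_id (c.Q_mapId_ν (U.U.obj a)) (EM_mapId_θ ((c.comparison U).obj a)))).trans
        (comp_eq_id (C := U.cod) (x := U.U.obj a) (U.U.map_id a) (comp_eq_id rfl rfl)).symm))
    (fun x =>
      (comp_eq_id rfl (comp_eq_id (c.Q_mapId_ν x) (EM_mapId_ν (X := c.qObj U) x))).trans
        (comp_eq_id rfl (comp_eq_id rfl rfl)).symm)
  naturality_comp {U V W} f g := LMFunc.hom₂_ext
    (fun a => Monad.Algebra.Hom.ext
      ((congrArg (fun s => (g.κ.inv.app (f.F.obj a) ≫ g.G.map (f.κ.inv.app a)) ≫ s)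
        (comp_eq_id (c.Q_mapComp_ν f g (U.U.obj a))
          (EM_mapComp_θ (c.qMap f) (c.qMap g) ((c.comparison U).obj a)))).trans (by
        change (g.κ.inv.app (f.F.obj a) ≫ g.G.map (f.κ.inv.app a)) ≫ 𝟙 _ =
          W.U.map (𝟙 _) ≫ 𝟙 _ ≫ g.κ.inv.app (f.F.obj a) ≫ 𝟙 _ ≫
            g.G.map (f.κ.inv.app a) ≫ 𝟙 _
        simp)))
    (fun x =>
      (comp_eq_id rfl
        (comp_eq_id (c.Q_mapComp_ν f g x) (EM_mapComp_ν (c.qMap f) (c.qMap g) x))).trans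
        (comp_eq_id rfl (comp_eq_id rfl (comp_eq_id rfl (comp_eq_id rfl
          (comp_eq_id (g.G.map_id _) rfl))))).symm)

/-! ### The triangle identities -/

/-- The triangle identity at `U`, on 1-cells. The 2-cell of the composite is `UŪη` followed by `UεŪ`,
once `compar_comp` is applied to the mate of the identity 2-cell of the comparison functor. -/
theorem qMap_unitApp_comp_counitApp (U : LMFunc.{v, u}) :
    c.qMap (c.unitApp U) ≫ c.counitApp (c.qObj U) = 𝟙 (c.qObj U) :=
  Bmd.Hom₁.mk_congr (l := (c.qMap (c.unitApp U) ≫ c.counitApp (c.qObj U)).laxG)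
    (l' := (𝟙 (c.qObj U) : c.qObj U ⟶ c.qObj U).laxG)
    (Functor.LaxMonoidal.ext (Category.comp_id _)
      (funext fun x => funext fun y => Category.comp_id _))
    (NatTrans.ext (funext fun (x : U.cod) => by
      let s : c.freeAlg (c.qObj U) x ⟶ (c.comparison U).obj ((c.L U).obj x) := c.ψ (c.unitApp U) x
      have hφ : c.φApp (c.unitApp U) x = s.f := Category.comp_id _
      have h : c.freeUnit (c.qObj U) x ≫ s.f = c.un U x :=
        (c.un_ψ (c.unitApp U) x).trans (Category.comp_id _)
      change c.compar (c.qObj U) x ≫ c.φApp (c.unitApp U) x = 𝟙 _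
      refine (congrArg (fun t => c.compar (c.qObj U) x ≫ t) hφ).trans ?_
      refine (c.compar_comp (c.qObj U) x s).trans ?_
      rw [h]
      change U.U.map ((c.L U).map (c.un U x)) ≫ U.U.map (c.co U _) = 𝟙 _
      rw [← Functor.map_comp, zigL, CategoryTheory.Functor.map_id]))

/-- The triangle identity at `T`, on 1-cells: the comparison functor of the chosen adjunction followed
by restriction along the comparison of monads fixes every algebra. -/
theorem unitApp_comp_emMap_counitApp (X : Bmd.{v, u}) :
    c.unitApp (Bmd.emObj X) ≫ Bmd.emMap (c.counitApp X) = 𝟙 (Bmd.emObj X) :=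
  Bmd.em_mk_congr (V := Bmd.emObj X) (Y := X) (K := X.T.forget)
    (a := { app := fun a => c.compar X a.A ≫ (c.freeCounit X a).f
            naturality := fun _ _ t =>
              ((c.comparison (Bmd.emObj X) ⋙ Bmd.algFunctor (c.counitApp X)).map t).h })
    (a' := Bmd.actId X) (fun a => c.compar_freeCounit X a) (Category.id_comp _)
    (fun _ _ => Category.id_comp _)
    (Functor.LaxMonoidal.ext (Category.comp_id _)
      (funext fun _ => funext fun _ => Category.comp_id _))
    (fun _ => Category.comp_id _)

/-- The first triangle identity. The unit has the identity as its component on base categories, so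
after `Q` its naturality 2-cells become identities. -/
theorem unitPost_vcomp_counitPre :
    (unitPost c.unit).vcomp (counitPre c.counit) =
      Pseudofunctor.StrongTrans.id c.Q.toPseudofunctor :=
  strongTrans_ext c.qMap_unitApp_comp_counitApp (fun {U V} f => Bmd.hom₂_ext (fun (x : U.cod) =>
    (comp_eq_id (C := V.cod) (x := f.G.obj x)
      (comp_eq_id rfl (comp_eq_id
        (comp_eq_id (c.Q_mapComp_inv_ν f (c.unitApp V) x)
          (comp_eq_id rfl (c.Q_mapComp_ν (c.unitApp U) (Bmd.emMap (c.qMap f)) x)))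
        (comp_eq_id rfl (comp_eq_id (c.counit_naturality_ν (c.qMap f) x) rfl))))
      (Bmd.eqToHom_ν_app (congrArg (· ≫ c.qMap f) (c.qMap_unitApp_comp_counitApp U)) x)).trans
    (comp_eq_id (C := V.cod) (x := f.G.obj x)
      (Bmd.eqToHom_ν_app (congrArg (c.qMap f ≫ ·) (c.qMap_unitApp_comp_counitApp V)) x)
      (comp_eq_id rfl rfl)).symm))

/-- The second triangle identity. At `EM f` the isomorphism `κ` is an identity, hence so are the
underlying morphisms of the naturality 2-cell `[κ⁻¹, 1]` of the unit. -/
theorem unitPre_vcomp_counitPost :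
    (unitPre c.unit).vcomp (counitPost c.counit) =
      Pseudofunctor.StrongTrans.id EM.{v, u}.toPseudofunctor :=
  strongTrans_ext c.unitApp_comp_emMap_counitApp (fun {X Y} f => LMFunc.hom₂_ext
    (fun (a : X.T.Algebra) => Monad.Algebra.Hom.ext
      ((comp_eq_id (C := Y.carrier) (x := f.G.obj a.A)
        (comp_eq_id rfl (comp_eq_id rfl (comp_eq_id rfl (comp_eq_id
          (comp_eq_id
            (EM_mapComp_inv_θ (c.qMap (Bmd.emMap f)) (c.counitApp Y)
              ((c.comparison (Bmd.emObj X)).obj a))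
            (comp_eq_id (c.counit_naturality_ν f a.A)
              (EM_mapComp_θ (c.counitApp X) f ((c.comparison (Bmd.emObj X)).obj a))))
          rfl))))
        (Bmd.em_eqToHom_θ_f
          (congrArg (· ≫ Bmd.emMap f) (c.unitApp_comp_emMap_counitApp X)) a)).trans
      (comp_eq_id (C := Y.carrier) (x := f.G.obj a.A)
        (Bmd.em_eqToHom_θ_f
          (congrArg (Bmd.emMap f ≫ ·) (c.unitApp_comp_emMap_counitApp Y)) a)
        (comp_eq_id rfl rfl)).symm))
    (fun (x : X.carrier) =>
      (comp_eq_id (C := Y.carrier) (x := f.G.obj x)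
        (comp_eq_id rfl (comp_eq_id rfl (comp_eq_id rfl (comp_eq_id
          (comp_eq_id
            (EM_mapComp_inv_ν (c.qMap (Bmd.emMap f)) (c.counitApp Y) x)
            (comp_eq_id (c.counit_naturality_ν f x)
              (EM_mapComp_ν (c.counitApp X) f x)))
          rfl))))
        (LMFunc.eqToHom_ν_app
          (congrArg (· ≫ Bmd.emMap f) (c.unitApp_comp_emMap_counitApp X)) x)).trans
      (comp_eq_id (C := Y.carrier) (x := f.G.obj x)
        (LMFunc.eqToHom_ν_app (congrArg (Bmd.emMap f ≫ ·) (c.unitApp_comp_emMap_counitApp Y)) x)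
        (comp_eq_id rfl rfl)).symm))

end AdjunctionChoice

end BimonadEM

theorem mainTheorem7 (c : BimonadEM.AdjunctionChoice.{v, u}) :
    ∃ (ζ : Pseudofunctor.StrongTrans
          (BimonadEM.EM.{v, u}.toPseudofunctor.comp c.Q.toPseudofunctor)
          (Pseudofunctor.id BimonadEM.Bmd.{v, u}))
      (ξ : Pseudofunctor.StrongTrans
          (Pseudofunctor.id BimonadEM.LMFunc.{v, u})
          (c.Q.toPseudofunctor.comp BimonadEM.EM.{v, u}.toPseudofunctor)),
      BimonadEM.Is2Natural ζ ∧
      (BimonadEM.unitPost ξ).vcomp (BimonadEM.counitPre ζ) =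
        Pseudofunctor.StrongTrans.id c.Q.toPseudofunctor ∧
      (BimonadEM.unitPre ξ).vcomp (BimonadEM.counitPost ζ) =
        Pseudofunctor.StrongTrans.id BimonadEM.EM.{v, u}.toPseudofunctor :=
  ⟨c.counit, c.unit, c.counit_is2Natural, c.unitPost_vcomp_counitPre, c.unitPre_vcomp_counitPost⟩
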